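/- **Setting.** Let $M$ be a smooth (finite-dimensional, Hausdorff) manifold. Vector bundles are smooth, real, of finite rank, and $\Gamma(A)$ denotes the smooth global sections of $A$. An *anchored bundle* $(A,M,\rho)$ is a vector bundle $A\to M$ with a smooth bundle homomorphism $\rho:A\to TM$ over $\mathrm{id}_M$. A *Lie algebroid* is an anchored bundle with a skew-symmetric $\mathbb R$-bilinear bracket on $\Gamma(A)$ with $[a,fb]=f[a,b]+\rho(a)(f)\,b$ for $f\in C^\infty(M)$, satisfying the Jacobi identity. A *right-anchored product* on $(A,M,\rho)$ is an $\mathbb R$-bilinear map $(a,b)\mapsto T_ab$ on $\Gamma(A)$ with $T_{fa}b=fT_ab$ and $T_a(fb)=fT_ab+\rho(a)(f)\,b$; put $[a,b]_T=T_ab-T_ba$ and $R^T(a,b)c=T_aT_bc-T_bT_ac-T_{[a,b]_T}c$. It is a *left symmetric algebroid* if $R^T=0$. The dual of $T$ acts on $\Gamma(A^*)$ by $\langle T^*_a\alpha,b\rangle=\rho(a)\cdot\langle\alpha,b\rangle-\langle\alpha,T_ab\rangle$. A *para-Kähler Lie algebroid* $(A,M,\rho,[\,,],\langle\,,\rangle,K)$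 is a Lie algebroid with a smooth nondegenerate symmetric bilinear form $\langle\,,\rangle$ on the fibres of $A$ and a smooth bundle isomorphism $K:A\to A$ such that $K^2=\mathrm{Id}$, $\langle Ka,b\rangle=-\langle a,Kb\rangle$ and $\nabla_a(Kb)=K\nabla_ab$, where $\nabla$ is the Levi-Civita connection, defined by $$2\langle\nabla_ab,c\rangle=\rho(a)\cdot\langle b,c\rangle+\rho(b)\cdot\langle a,c\rangle-\rho(c)\cdot\langle a,b\rangle+\langle[c,a],b\rangle+\langle[c,b],a\rangle+\langle[a,b],c\rangle .$$ Let $(B,M,\rho_0,S)$ and $(B^*,M,\rho_1,T)$ be left symmetric algebroids on dual vector bundles. On $\Gamma(B\oplus B^*)$ put, for $X,Y\in\Gamma(B)$ and $\alpha,\beta\in\Gamma(B^*)$, $$\nabla_{X+\alpha}(Y+\beta)=S_XY+T^*_\alpha Y+S^*_X\beta+T_\alpha\beta,$$ $$[X+\alpha,Y+\beta]_\phi=[X,Y]_S+[\alpha,\beta]_T+T^*_\alpha Y-T^*_\beta X+S^*_X\beta-S^*_Y\alpha ,$$ where $T^*$ acts on $\Gamma(B)=\Gamma(B^{**})$. The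 two algebroids are *Lie-extendible* (compatible) if for all such $X,Y,\alpha,\beta$ $$R^\nabla(X,\alpha)Y=R^\nabla(Y,\alpha)X\quad\text{and}\quad R^\nabla(\alpha,X)\beta=R^\nabla(\beta,X)\alpha .$$ **Theorem.** (1) If $(B,M,\rho_0,S)$ and $(B^*,M,\rho_1,T)$ are Lie-extendible left symmetric algebroids, then the phase space $\Phi(B)=B\oplus B^*$ with the anchor $\rho_0\oplus\rho_1:u+\alpha\mapsto\rho_0(u)+\rho_1(\alpha)$, the bracket $[\,,]_\phi$, the form $\langle u+\alpha,v+\beta\rangle_0=\alpha(v)+\beta(u)$ and $K_0(u+\alpha)=u-\alpha$ is a para-Kähler Lie algebroid. (2) Conversely, for every para-Kähler Lie algebroid $(A,M,\rho,[\,,],\langle\,,\rangle,K)$ there are a vector bundle $B\to M$, Lie-extendible left symmetric algebroids $(B,M,\rho_0,S)$ and $(B^*,M,\rho_1,T)$, and an isomorphism of smooth vector bundles $\Psi:B\oplus B^*\to A$ over $\mathrm{id}_M$ with $\rho\circ\Psi=\rho_0\oplus\rho_1$, $\Psi[u,v]_\phi=[\Psi u,\Psi v]$ for all sections $u,v$ of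 $B\oplus B^*$, $\langle\Psi v,\Psi w\rangle=\langle v,w\rangle_0$ and $K\circ\Psi=\Psi\circ K_0$. -/

import Mathlib

open Bundle Set Filter
open scoped Manifold ContDiff Topology Bundle

set_option linter.unusedSectionVars false

noncomputable section

namespace ParaKahler

section SmoothBundles

variable (E : Type*) [NormedAddCommGroup E] [NormedSpace ℝ E]
  {M : Type*} [TopologicalSpace M] [ChartedSpace E M]
  (F : Type*) [NormedAddCommGroup F] [NormedSpace ℝ F]
  (A : M → Type*) [∀ x, AddCommGroup (A x)] [∀ x, Module ℝ (A x)] [∀ x, TopologicalSpace (A x)]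
  [TopologicalSpace (TotalSpace F A)] [FiberBundle F A] [VectorBundle ℝ F A]
  {F' : Type*} [NormedAddCommGroup F'] [NormedSpace ℝ F']
  {A' : M → Type*} [∀ x, AddCommGroup (A' x)] [∀ x, Module ℝ (A' x)]
  [∀ x, TopologicalSpace (A' x)]
  [TopologicalSpace (TotalSpace F' A')] [FiberBundle F' A'] [VectorBundle ℝ F' A']

/-- `Γ(A)`: the smooth global sections of the vector bundle `A → M` with typical fibre `F`,
over a manifold `M` modelled on `E`. -/
abbrev Sec := ContMDiffSection 𝓘(ℝ, E) F ∞ A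

variable (M) in
/-- `C^∞(M)`. -/
abbrev Fun := ContMDiffMap 𝓘(ℝ, E) 𝓘(ℝ, ℝ) M ℝ ∞

variable {E F A}

/-- Multiplication of a smooth section by a smooth function. -/
instance : SMul (Fun E M) (Sec E F A) :=
  ⟨fun f s => ⟨fun x => f x • s x, f.contMDiff.smul_section s.contMDiff⟩⟩

@[simp] theorem fun_smul_apply (f : Fun E M) (s : Sec E F A) (x : M) :
    (f • s) x = f x • s x := rfl

variable (E F F') in
/-- A fibrewise linear map `A → A'` over the identity of `M` is a morphism of smooth vector
bundles if it is smooth as a map between total spaces. -/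
def IsSmoothHom (H : ∀ x, A x →ₗ[ℝ] A' x) : Prop :=
  ContMDiff (𝓘(ℝ, E).prod 𝓘(ℝ, F)) (𝓘(ℝ, E).prod 𝓘(ℝ, F')) ∞
    (fun v : TotalSpace F A => (⟨v.proj, H v.proj v.snd⟩ : TotalSpace F' A'))

/-- The section `x ↦ H (s x)`, for a morphism of smooth vector bundles `H`. -/
def mapSec {H : ∀ x, A x →ₗ[ℝ] A' x} (hH : IsSmoothHom E F F' H) (s : Sec E F A) :
    Sec E F' A' :=
  ⟨fun x => H x (s x), hH.comp s.contMDiff⟩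

@[simp] theorem mapSec_apply {H : ∀ x, A x →ₗ[ℝ] A' x} (hH : IsSmoothHom E F F' H)
    (s : Sec E F A) (x : M) : mapSec hH s x = H x (s x) := rfl

end SmoothBundles

section Representation

variable {E : Type*} [NormedAddCommGroup E] [NormedSpace ℝ E] [FiniteDimensional ℝ E]
  {M : Type*} [TopologicalSpace M] [ChartedSpace E M] [IsManifold 𝓘(ℝ, E) ∞ M] [T2Space M]
  {F : Type*} [NormedAddCommGroup F] [NormedSpace ℝ F] [FiniteDimensional ℝ F]
  {A : M → Type*} [∀ x, AddCommGroup (A x)] [∀ x, Module ℝ (A x)] [∀ x, TopologicalSpace (A x)]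
  [TopologicalSpace (TotalSpace F A)] [FiberBundle F A] [VectorBundle ℝ F A]
  [ContMDiffVectorBundle ∞ F A 𝓘(ℝ, E)]
  {F' : Type*} [NormedAddCommGroup F'] [NormedSpace ℝ F'] [FiniteDimensional ℝ F']
  {A' : M → Type*} [∀ x, AddCommGroup (A' x)] [∀ x, Module ℝ (A' x)]
  [∀ x, TopologicalSpace (A' x)]
  [TopologicalSpace (TotalSpace F' A')] [FiberBundle F' A'] [VectorBundle ℝ F' A']
  [ContMDiffVectorBundle ∞ F' A' 𝓘(ℝ, E)]

theorem sum_sec_apply {ι : Type*} (u : Finset ι) (s : ι → Sec E F A) (x : M) :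
    (∑ i ∈ u, s i) x = ∑ i ∈ u, s i x := by
  have := congrFun (map_sum (ContMDiffSection.coeAddHom 𝓘(ℝ, E) F ∞ A) s u) x
  rw [Finset.sum_apply] at this
  exact this

/-- Near every point, global smooth sections provide a frame; all sections, multiplied by the
square of a cut-off function, are combinations of this frame. -/
theorem exists_frame (E F : Type*) [NormedAddCommGroup E] [NormedSpace ℝ E]
    [FiniteDimensional ℝ E]
    {M : Type*} [TopologicalSpace M] [ChartedSpace E M] [IsManifold 𝓘(ℝ, E) ∞ M] [T2Space M]
    [NormedAddCommGroup F] [NormedSpace ℝ F] [FiniteDimensional ℝ F]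
    {A : M → Type*} [∀ x, AddCommGroup (A x)] [∀ x, Module ℝ (A x)]
    [∀ x, TopologicalSpace (A x)]
    [TopologicalSpace (TotalSpace F A)] [FiberBundle F A] [VectorBundle ℝ F A]
    [ContMDiffVectorBundle ∞ F A 𝓘(ℝ, E)] {ι : Type*} [Fintype ι] (b : Module.Basis ι ℝ F)
    (x₀ : M) :
    ∃ (χ : Fun E M) (e : ι → Sec E F A) (L : ι → ∀ x, A x →ₗ[ℝ] ℝ) (c : ι → Sec E F A → Fun E M),
      (∀ i s x, c i s x = L i x (s x)) ∧
      (∀ s, (χ * χ) • s = ∑ i, c i s • e i) ∧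
      (∀ᶠ x in 𝓝 x₀, χ x = 1 ∧ LinearIndependent ℝ (fun i => e i x) ∧
        ∀ v : A x, v = ∑ i, L i x v • e i x) := by
  classical
  have : ContMDiffVectorBundle 1 F A 𝓘(ℝ, E) := ContMDiffVectorBundle.of_le (n := ∞) (by simp)
  let t := trivializationAt F A x₀
  have hx₀ : x₀ ∈ t.baseSet := mem_baseSet_trivializationAt F A x₀
  obtain ⟨f, hf⟩ : ∃ f : SmoothBumpFunction 𝓘(ℝ, E) x₀, tsupport f ⊆ t.baseSet := by
    obtain ⟨f, hf, -⟩ := ((SmoothBumpFunction.nhds_basis_support (I := 𝓘(ℝ, E))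
      (t.open_baseSet.mem_nhds hx₀))).mem_iff.1 (t.open_baseSet.mem_nhds hx₀)
    exact ⟨f, hf⟩
  let χ : Fun E M := ⟨f, f.contMDiff⟩
  have hχ0 : ∀ x, x ∉ t.baseSet → f x = 0 := fun x hx =>
    image_eq_zero_of_notMem_tsupport fun h => hx (hf h)
  let e : ι → Sec E F A := fun i => ⟨fun x => f x • t.localFrame b i x,
    ContMDiffOn.smul_section_of_tsupport f.contMDiff.contMDiffOn t.open_baseSet hf
      (t.contMDiffOn_localFrame_baseSet ∞ b i)⟩
  let L : ι → ∀ x, A x →ₗ[ℝ] ℝ := fun i x => f x • t.localFrameCoeff 𝓘(ℝ, E) b i x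
  have hsm : ∀ i (s : Sec E F A), ContMDiff 𝓘(ℝ, E) 𝓘(ℝ, ℝ) ∞ (fun x => L i x (s x)) := by
    intro i s
    refine contMDiff_of_contMDiffOn_union_of_isOpen (s := t.baseSet) (t := (tsupport f)ᶜ)
      ?_ ?_ ?_ t.open_baseSet (isOpen_compl_iff.mpr <| isClosed_tsupport f)
    · exact (f.contMDiff.contMDiffOn).mul
        (contMDiffOn_baseSet_localFrameCoeff b s.contMDiff.contMDiffOn i)
    · refine (contMDiffOn_const (c := (0 : ℝ))).congr fun x hx => ?_
      simp [L, image_eq_zero_of_notMem_tsupport hx]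
    · exact Set.compl_subset_iff_union.mp <| Set.compl_subset_compl.mpr hf
  let c : ι → Sec E F A → Fun E M := fun i s => ⟨fun x => L i x (s x), hsm i s⟩
  refine ⟨χ, e, L, c, fun _ _ _ => rfl, fun s => ?_, ?_⟩
  · ext x
    rw [sum_sec_apply]
    show (f x * f x) • s x = ∑ i, (f x * t.localFrameCoeff 𝓘(ℝ, E) b i x (s x)) •
      (f x • t.localFrame b i x)
    by_cases hx : x ∈ t.baseSet
    · conv_lhs => rw [t.eq_sum_localFrameCoeff_smul (I := 𝓘(ℝ, E)) (b := b) (s := s) hx]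
      rw [Finset.smul_sum]
      refine Finset.sum_congr rfl fun i _ => ?_
      rw [smul_smul, smul_smul]; congr 1; ring
    · simp [hχ0 x hx]
  · filter_upwards [f.eventuallyEq_one, t.open_baseSet.mem_nhds hx₀] with x h1 hx
    have h1' : f x = 1 := h1
    refine ⟨h1', ?_, fun v => ?_⟩
    · simpa [e, h1'] using (t.isLocalFrameOn_localFrame_baseSet 𝓘(ℝ, E) ∞ b).linearIndependent hx
    · have := t.eq_sum_localFrameCoeff_smul (I := 𝓘(ℝ, E)) (b := b)
        (s := Function.update (fun _ => 0) x v) hx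
      simp only [Function.update_self] at this
      simpa only [L, e, h1', one_smul, ContMDiffSection.coeFn_mk] using this

/-- Every vector of a fibre is the value of a global smooth section. -/
theorem exists_sec_apply_eq (x₀ : M) (v : A x₀) : ∃ s : Sec E F A, s x₀ = v := by
  obtain ⟨χ, e, L, c, -, -, h⟩ := exists_frame E F (A := A) (Module.finBasis ℝ F) x₀
  obtain ⟨-, -, h⟩ := h.self_of_nhds
  refine ⟨∑ i, L i x₀ v • e i, ?_⟩
  rw [sum_sec_apply]
  exact (h v).symm

/-- A fibrewise perfect pairing, smooth on sections, represents every `C^∞(M)`-linear functional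
on sections by a smooth section. -/
theorem exists_sec_of_tensorial (P : ∀ x, A x →ₗ[ℝ] A' x →ₗ[ℝ] ℝ)
    (hP : ∀ x, Function.Bijective (P x))
    (hsm : ∀ (s : Sec E F A) (t : Sec E F' A'),
      ContMDiff 𝓘(ℝ, E) 𝓘(ℝ, ℝ) ∞ (fun x => P x (s x) (t x)))
    (φ : Sec E F' A' → M → ℝ) (hφ : ∀ t, ContMDiff 𝓘(ℝ, E) 𝓘(ℝ, ℝ) ∞ (φ t))
    (hadd : ∀ t t' x, φ (t + t') x = φ t x + φ t' x)
    (hsmul : ∀ (f : Fun E M) t x, φ (f • t) x = f x * φ t x) :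
    ∃ s : Sec E F A, ∀ t x, P x (s x) (t x) = φ t x := by
  classical
  have hsum : ∀ {ι : Type} (u : Finset ι) (t : ι → Sec E F' A') x,
      φ (∑ i ∈ u, t i) x = ∑ i ∈ u, φ (t i) x := by
    intro ι u t x
    let Φ : Sec E F' A' →+ ℝ := AddMonoidHom.mk' (fun t => φ t x) (fun t t' => hadd t t' x)
    exact map_sum Φ t u
  have key : ∀ x, ∃ v : A x, ∀ t, P x v (t x) = φ t x := by
    intro x
    obtain ⟨χ, e, L, c, hc, hs, h⟩ := exists_frame E F' (A := A') (Module.finBasis ℝ F') x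
    obtain ⟨h1, -, -⟩ := h.self_of_nhds
    obtain ⟨v, hv⟩ := (hP x).2 (∑ i, φ (e i) x • L i x)
    refine ⟨v, fun t => ?_⟩
    have h2 := congrArg (fun t => φ t x) (hs t)
    simp only [hsum, hsmul] at h2
    rw [ContMDiffMap.coe_mul, Pi.mul_apply, h1, one_mul, one_mul] at h2
    rw [hv, h2]
    simp [hc, mul_comm]
  choose σ hσ using key
  refine ⟨⟨σ, fun x₀ => ?_⟩, fun t x => hσ x t⟩
  have hfin : ∀ x, Module.finrank ℝ (A x) = Module.finrank ℝ F := fun x =>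
    ((trivializationAt F A x).linearEquivAt ℝ x (mem_baseSet_trivializationAt F A x)).finrank_eq
  have hfin' : ∀ x, Module.finrank ℝ (A' x) = Module.finrank ℝ F' := fun x =>
    ((trivializationAt F' A' x).linearEquivAt ℝ x
      (mem_baseSet_trivializationAt F' A' x)).finrank_eq
  have hrk : Module.finrank ℝ F' = Module.finrank ℝ F := by
    rw [← hfin x₀, ← hfin' x₀, ← Subspace.dual_finrank_eq (K := ℝ) (V := A' x₀)]
    exact (LinearEquiv.ofBijective (P x₀) (hP x₀)).finrank_eq.symm
  obtain ⟨_, e, L, _, -, -, he⟩ := exists_frame E F (A := A) (Module.finBasis ℝ F) x₀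
  obtain ⟨_, e', L', _, -, -, he'⟩ :=
    exists_frame E F' (A := A') (Module.finBasisOfFinrankEq ℝ F' hrk) x₀
  let Q : M → Matrix (Fin (Module.finrank ℝ F)) (Fin (Module.finrank ℝ F)) ℝ :=
    fun x => Matrix.of fun j k => P x (e k x) (e' j x)
  let w : M → Fin (Module.finrank ℝ F) → ℝ := fun x j => φ (e' j) x
  have hdet : ∀ (R : M → Matrix (Fin (Module.finrank ℝ F)) (Fin (Module.finrank ℝ F)) ℝ),
      (∀ j k, ContMDiff 𝓘(ℝ, E) 𝓘(ℝ, ℝ) ∞ (fun x => R x j k)) →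
      ContMDiff 𝓘(ℝ, E) 𝓘(ℝ, ℝ) ∞ (fun x => (R x).det) := by
    intro R hR
    simp only [Matrix.det_apply']
    exact contMDiff_finsetSum fun p _ => contMDiff_const.mul (contMDiff_finsetProd fun i _ => hR _ _)
  have hQ : ContMDiff 𝓘(ℝ, E) 𝓘(ℝ, ℝ) ∞ (fun x => (Q x).det) := hdet Q fun j k => hsm _ _
  have hcr : ∀ k, ContMDiff 𝓘(ℝ, E) 𝓘(ℝ, ℝ) ∞ (fun x => (Q x).cramer (w x) k) := by
    intro k
    simp only [Matrix.cramer_apply]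
    refine hdet _ fun i j => ?_
    by_cases hj : j = k
    · subst hj; simpa [Matrix.updateCol_self] using hφ _
    · simpa [Matrix.updateCol_ne hj, Q] using hsm _ _
  have hne : ∀ᶠ x in 𝓝 x₀, (Q x).det ≠ 0 := by
    filter_upwards [he, he'] with x hx hx'
    intro h0
    obtain ⟨v, hv, hv0⟩ := Matrix.exists_mulVec_eq_zero_iff.2 h0
    apply hv
    have h1 : P x (∑ k, v k • e k x) = 0 := by
      have h0 : ∀ j, P x (∑ k, v k • e k x) (e' j x) = 0 := by
        intro j
        have := congrFun hv0 j
        simp only [Q, Matrix.mulVec, dotProduct, Matrix.of_apply, Pi.zero_apply] at this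
        rw [map_sum, LinearMap.sum_apply, ← this]
        exact Finset.sum_congr rfl fun d _ => by
          rw [map_smul, LinearMap.smul_apply, smul_eq_mul, mul_comm]
      refine LinearMap.ext fun u => ?_
      rw [hx'.2.2 u, map_sum]
      exact Finset.sum_eq_zero fun j _ => by rw [map_smul, h0 j, smul_zero]
    have h2 : ∑ k, v k • e k x = 0 := (hP x).1 (by rw [h1, map_zero])
    funext k
    exact Fintype.linearIndependent_iff.1 hx.2.1 v h2 k
  have hsol : ∀ᶠ x in 𝓝 x₀, σ x = ∑ k, ((Q x).cramer (w x) k / (Q x).det) • e k x := by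
    filter_upwards [he', hne] with x hx' hx
    apply (hP x).1
    ext u
    rw [hx'.2.2 u]
    simp only [map_sum, map_smul, LinearMap.sum_apply, LinearMap.smul_apply]
    refine Finset.sum_congr rfl fun j _ => ?_
    congr 1
    rw [hσ x (e' j)]
    have := congrFun (Matrix.mulVec_cramer (Q x) (w x)) j
    simp only [Matrix.mulVec, dotProduct, Pi.smul_apply, smul_eq_mul, Q, Matrix.of_apply] at this
    have h3 : w x j = φ (e' j) x := rfl
    rw [← h3]
    have h4 : ∑ k, (Q x).cramer (w x) k / (Q x).det * P x (e k x) (e' j x) =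
        (∑ k, P x (e k x) (e' j x) * (Q x).cramer (w x) k) / (Q x).det := by
      rw [Finset.sum_div]
      exact Finset.sum_congr rfl fun k _ => by ring
    simp only [smul_eq_mul]
    rw [h4]
    refine (eq_div_of_mul_eq hx ?_)
    rw [mul_comm]; exact this.symm
  refine ContMDiffAt.congr_of_eventuallyEq
    (f := fun x => (⟨x, ∑ k, ((Q x).cramer (w x) k / (Q x).det) • e k x⟩ : TotalSpace F A)) ?_ ?_
  · refine ContMDiffAt.sum_section fun k _ => ContMDiffAt.smul_section ?_ (e k).contMDiff.contMDiffAt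
    exact (hcr k).contMDiffAt.div₀ hQ.contMDiffAt hne.self_of_nhds
  · filter_upwards [hsol] with x hx
    simp [hx]


theorem contMDiff_mvfderiv_apply {ρ : ∀ x : M, A x →ₗ[ℝ] TangentSpace 𝓘(ℝ, E) x}
    (hρ : IsSmoothHom E F E ρ) (a : Sec E F A) {f : M → ℝ}
    (hf : ContMDiff 𝓘(ℝ, E) 𝓘(ℝ, ℝ) ∞ f) :
    ContMDiff 𝓘(ℝ, E) 𝓘(ℝ, ℝ) ∞ (fun x => mvfderiv 𝓘(ℝ, E) f x (ρ x (a x))) := by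
  have h1 := (hf.contMDiff_tangentMap (m := ∞) (by simp)).comp (mapSec hρ a).contMDiff
  exact (contMDiff_snd_tangentBundle_modelSpace ℝ 𝓘(ℝ, ℝ)).comp h1

end Representation

section Algebroids

variable {E : Type*} [NormedAddCommGroup E] [NormedSpace ℝ E]
  {M : Type*} [TopologicalSpace M] [ChartedSpace E M] [IsManifold 𝓘(ℝ, E) ∞ M]
  {F : Type*} [NormedAddCommGroup F] [NormedSpace ℝ F]
  {A : M → Type*} [∀ x, AddCommGroup (A x)] [∀ x, Module ℝ (A x)] [∀ x, TopologicalSpace (A x)]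
  [TopologicalSpace (TotalSpace F A)] [FiberBundle F A] [VectorBundle ℝ F A]

/-- The function `ρ(a)(f) : M → ℝ`, the derivative of `f` along the vector field `ρ(a)`. -/
def anchorDeriv (ρ : ∀ x, A x →ₗ[ℝ] TangentSpace 𝓘(ℝ, E) x) (a : Sec E F A) (f : M → ℝ)
    (x : M) : ℝ :=
  mvfderiv 𝓘(ℝ, E) f x (ρ x (a x))

/-- `(A, M, ρ, [·,·])` is a Lie algebroid: `ρ : A → TM` is a bundle homomorphism and `[·,·]` is a
skew-symmetric `ℝ`-bilinear anchored bracket on `Γ(A)` whose Jacobiator vanishes. -/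
structure IsLieAlgebroid (ρ : ∀ x, A x →ₗ[ℝ] TangentSpace 𝓘(ℝ, E) x)
    (br : Sec E F A → Sec E F A → Sec E F A) : Prop where
  smooth_anchor : IsSmoothHom E F E ρ
  skew : ∀ a b, br a b = -br b a
  add_right : ∀ a b c, br a (b + c) = br a b + br a c
  smul_right : ∀ (r : ℝ) a b, br a (r • b) = r • br a b
  anchored : ∀ (f : Fun E M) a b x,
    br a (f • b) x = f x • br a b x + anchorDeriv ρ a f x • b x
  jacobi : ∀ a b c, br (br a b) c + br (br b c) a + br (br c a) b = 0

/-- A right-anchored product on the anchored bundle `(A, M, ρ)`: an `ℝ`-bilinear map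
`(a, b) ↦ T_a b` with `T_{fa} b = f T_a b` and `T_a (fb) = f T_a b + ρ(a)(f) b`. -/
structure IsRightAnchoredProduct (ρ : ∀ x, A x →ₗ[ℝ] TangentSpace 𝓘(ℝ, E) x)
    (T : Sec E F A → Sec E F A → Sec E F A) : Prop where
  smooth_anchor : IsSmoothHom E F E ρ
  add_left : ∀ a b c, T (a + b) c = T a c + T b c
  add_right : ∀ a b c, T a (b + c) = T a b + T a c
  smul_left : ∀ (r : ℝ) a b, T (r • a) b = r • T a b
  smul_right : ∀ (r : ℝ) a b, T a (r • b) = r • T a b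
  fun_smul_left : ∀ (f : Fun E M) a b, T (f • a) b = f • T a b
  fun_smul_right : ∀ (f : Fun E M) a b x,
    T a (f • b) x = f x • T a b x + anchorDeriv ρ a f x • b x

/-- The bracket `[a, b]_T = T_a b - T_b a`. -/
def prodBracket (T : Sec E F A → Sec E F A → Sec E F A) (a b : Sec E F A) : Sec E F A :=
  T a b - T b a

/-- The curvature `R^T(a, b) c = [T_a, T_b] c - T_{[a, b]_T} c`. -/
def curvature (T : Sec E F A → Sec E F A → Sec E F A) (a b c : Sec E F A) : Sec E F A :=
  T a (T b c) - T b (T a c) - T (prodBracket T a b) c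

/-- A left symmetric algebroid: an anchored bundle with a right-anchored product of vanishing
curvature. -/
structure IsLeftSymmetricAlgebroid (ρ : ∀ x, A x →ₗ[ℝ] TangentSpace 𝓘(ℝ, E) x)
    (T : Sec E F A → Sec E F A → Sec E F A) : Prop extends IsRightAnchoredProduct ρ T where
  flat : ∀ a b c, curvature T a b c = 0

variable (E F) in
/-- A pseudo-Riemannian metric on the vector bundle `A`: a nondegenerate symmetric bilinear form
on every fibre such that `⟨a, b⟩` is smooth for all local smooth sections `a`, `b`. -/
structure IsPseudoRiemannian (g : ∀ x, A x →ₗ[ℝ] A x →ₗ[ℝ] ℝ) : Prop where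
  symm : ∀ x u v, g x u v = g x v u
  nondegenerate : ∀ x u, (∀ v, g x u v = 0) → u = 0
  smooth : ∀ (U : Set M) (a b : ∀ x, A x), IsOpen U →
    ContMDiffOn 𝓘(ℝ, E) (𝓘(ℝ, E).prod 𝓘(ℝ, F)) ∞ (fun x => (⟨x, a x⟩ : TotalSpace F A)) U →
    ContMDiffOn 𝓘(ℝ, E) (𝓘(ℝ, E).prod 𝓘(ℝ, F)) ∞ (fun x => (⟨x, b x⟩ : TotalSpace F A)) U →
    ContMDiffOn 𝓘(ℝ, E) 𝓘(ℝ, ℝ) ∞ (fun x => g x (a x) (b x)) U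

/-- The right-hand side of the Koszul formula divided by `2`: the value which `⟨∇_a b, c⟩` has to take. -/
def koszul (ρ : ∀ x, A x →ₗ[ℝ] TangentSpace 𝓘(ℝ, E) x)
    (br : Sec E F A → Sec E F A → Sec E F A) (g : ∀ x, A x →ₗ[ℝ] A x →ₗ[ℝ] ℝ)
    (a b c : Sec E F A) (x : M) : ℝ :=
  (anchorDeriv ρ a (fun y => g y (b y) (c y)) x + anchorDeriv ρ b (fun y => g y (a y) (c y)) x
    - anchorDeriv ρ c (fun y => g y (a y) (b y)) x
    + g x (br c a x) (b x) + g x (br c b x) (a x) + g x (br a b x) (c x)) / 2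

variable [FiniteDimensional ℝ E] [T2Space M] [FiniteDimensional ℝ F]
  [ContMDiffVectorBundle ∞ F A 𝓘(ℝ, E)]

theorem IsPseudoRiemannian.contMDiff {g : ∀ x, A x →ₗ[ℝ] A x →ₗ[ℝ] ℝ}
    (hg : IsPseudoRiemannian E F g) (a b : Sec E F A) :
    ContMDiff 𝓘(ℝ, E) 𝓘(ℝ, ℝ) ∞ (fun x => g x (a x) (b x)) :=
  contMDiffOn_univ.1 (hg.smooth univ a b isOpen_univ a.contMDiff.contMDiffOn
    b.contMDiff.contMDiffOn)

theorem finiteDimensional_fibre (F : Type*) [NormedAddCommGroup F] [NormedSpace ℝ F]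
    {M : Type*} [TopologicalSpace M]
    {A : M → Type*} [∀ x, AddCommGroup (A x)] [∀ x, Module ℝ (A x)]
    [∀ x, TopologicalSpace (A x)]
    [TopologicalSpace (TotalSpace F A)] [FiberBundle F A] [VectorBundle ℝ F A]
    [FiniteDimensional ℝ F] (x : M) : FiniteDimensional ℝ (A x) :=
  ((trivializationAt F A x).linearEquivAt ℝ x
    (mem_baseSet_trivializationAt F A x)).symm.finiteDimensional

theorem IsPseudoRiemannian.bijective {g : ∀ x, A x →ₗ[ℝ] A x →ₗ[ℝ] ℝ}
    (hg : IsPseudoRiemannian E F g) (x : M) : Function.Bijective (g x) := by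
  have := finiteDimensional_fibre F (A := A) x
  have hinj : Function.Injective (g x) := by
    rw [injective_iff_map_eq_zero]
    exact fun u hu => hg.nondegenerate x u fun v => by rw [hu]; rfl
  exact ⟨hinj, (LinearMap.injective_iff_surjective_of_finrank_eq_finrank
    (Subspace.dual_finrank_eq (K := ℝ) (V := A x)).symm).1 hinj⟩

theorem anchorDeriv_add {ρ : ∀ x, A x →ₗ[ℝ] TangentSpace 𝓘(ℝ, E) x} {a : Sec E F A} {f g : M → ℝ}
    (hf : ContMDiff 𝓘(ℝ, E) 𝓘(ℝ, ℝ) ∞ f) (hg : ContMDiff 𝓘(ℝ, E) 𝓘(ℝ, ℝ) ∞ g) (x : M) :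
    anchorDeriv ρ a (fun y => f y + g y) x = anchorDeriv ρ a f x + anchorDeriv ρ a g x := by
  unfold anchorDeriv
  rw [mvfderiv_fun_add (hf.mdifferentiable (by simp) x) (hg.mdifferentiable (by simp) x)]
  rfl

theorem anchorDeriv_mul {ρ : ∀ x, A x →ₗ[ℝ] TangentSpace 𝓘(ℝ, E) x} {a : Sec E F A} {f g : M → ℝ}
    (hf : ContMDiff 𝓘(ℝ, E) 𝓘(ℝ, ℝ) ∞ f) (hg : ContMDiff 𝓘(ℝ, E) 𝓘(ℝ, ℝ) ∞ g) (x : M) :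
    anchorDeriv ρ a (fun y => f y * g y) x =
      f x * anchorDeriv ρ a g x + anchorDeriv ρ a f x * g x := by
  unfold anchorDeriv
  rw [mvfderiv_fun_mul (hf.mdifferentiable (by simp) x) (hg.mdifferentiable (by simp) x)]
  simp [mul_comm]

theorem exists_leviCivita {ρ : ∀ x, A x →ₗ[ℝ] TangentSpace 𝓘(ℝ, E) x}
    {br : Sec E F A → Sec E F A → Sec E F A} {g : ∀ x, A x →ₗ[ℝ] A x →ₗ[ℝ] ℝ}
    (hL : IsLieAlgebroid ρ br) (hg : IsPseudoRiemannian E F g) (a b : Sec E F A) :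
    ∃ s : Sec E F A, ∀ (c : Sec E F A) x, g x (s x) (c x) = koszul ρ br g a b c x := by
  have hD := fun (a : Sec E F A) (b c : Sec E F A) =>
    contMDiff_mvfderiv_apply hL.smooth_anchor a (hg.contMDiff b c)
  have hadd_left : ∀ a b c, br (a + b) c = br a c + br b c := fun a b c => by
    rw [hL.skew, hL.add_right, hL.skew c a, hL.skew c b]; abel
  have hleft : ∀ (f : Fun E M) a b x,
      br (f • a) b x = f x • br a b x - anchorDeriv ρ b f x • a x := fun f a b x => by
    rw [hL.skew (f • a) b, hL.skew a b]
    simp only [ContMDiffSection.coe_neg, Pi.neg_apply, hL.anchored]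
    module
  refine exists_sec_of_tensorial g hg.bijective hg.contMDiff (koszul ρ br g a b) (fun c => ?_)
    (fun c d x => ?_) (fun f c x => ?_)
  · unfold koszul
    exact ((((((hD a b c).add (hD b a c)).sub (hD c a b)).add (hg.contMDiff _ _)).add
      (hg.contMDiff _ _)).add (hg.contMDiff _ _)).div_const 2
  · unfold koszul
    simp only [ContMDiffSection.coe_add, Pi.add_apply, map_add, LinearMap.add_apply, hadd_left,
      anchorDeriv_add (hg.contMDiff _ _) (hg.contMDiff _ _)]
    simp only [anchorDeriv, ContMDiffSection.coe_add, Pi.add_apply, map_add]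
    ring
  · unfold koszul
    simp only [fun_smul_apply, map_smul, smul_eq_mul, hleft, map_sub, LinearMap.sub_apply,
      LinearMap.smul_apply, anchorDeriv_mul f.contMDiff (hg.contMDiff _ _)]
    rw [hg.symm x (c x) (b x), hg.symm x (c x) (a x)]
    have : anchorDeriv ρ (f • c) (fun y => g y (a y) (b y)) x =
        f x * anchorDeriv ρ c (fun y => g y (a y) (b y)) x := by
      simp [anchorDeriv]
    rw [this]
    ring

/-- The Levi-Civita connection `∇` of a pseudo-Riemannian Lie algebroid, defined by the Koszul
formula. -/
def leviCivita {ρ : ∀ x, A x →ₗ[ℝ] TangentSpace 𝓘(ℝ, E) x}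
    {br : Sec E F A → Sec E F A → Sec E F A} {g : ∀ x, A x →ₗ[ℝ] A x →ₗ[ℝ] ℝ}
    (hL : IsLieAlgebroid ρ br) (hg : IsPseudoRiemannian E F g) (a b : Sec E F A) : Sec E F A :=
  Classical.choose (exists_leviCivita hL hg a b)

theorem leviCivita_spec {ρ : ∀ x, A x →ₗ[ℝ] TangentSpace 𝓘(ℝ, E) x}
    {br : Sec E F A → Sec E F A → Sec E F A} {g : ∀ x, A x →ₗ[ℝ] A x →ₗ[ℝ] ℝ}
    (hL : IsLieAlgebroid ρ br) (hg : IsPseudoRiemannian E F g) (a b c : Sec E F A) (x : M) :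
    g x (leviCivita hL hg a b x) (c x) = koszul ρ br g a b c x :=
  Classical.choose_spec (exists_leviCivita hL hg a b) c x

/-- A para-Kähler Lie algebroid `(A, M, ρ, [·,·], ⟨·,·⟩, K)`: a pseudo-Riemannian Lie algebroid
with a skew-symmetric bundle isomorphism `K` such that `K² = Id` and `∇K = 0`, that is
`∇_a (K b) = K (∇_a b)`, for the Levi-Civita connection `∇`. -/
structure IsParaKahler (ρ : ∀ x, A x →ₗ[ℝ] TangentSpace 𝓘(ℝ, E) x)
    (br : Sec E F A → Sec E F A → Sec E F A) (g : ∀ x, A x →ₗ[ℝ] A x →ₗ[ℝ] ℝ)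
    (K : ∀ x, A x →ₗ[ℝ] A x) : Prop where
  lie : IsLieAlgebroid ρ br
  metric : IsPseudoRiemannian E F g
  smooth : IsSmoothHom E F F K
  sq : ∀ x u, K x (K x u) = u
  skew : ∀ x u v, g x (K x u) v = -g x u (K x v)
  parallel : ∀ a b, leviCivita lie metric a (mapSec smooth b) =
    mapSec smooth (leviCivita lie metric a b)

end Algebroids

section PhaseSpace

/-- `B*`, the dual vector bundle, with typical fibre `F →L[ℝ] ℝ`. -/
abbrev Dual {M : Type*} (B : M → Type*) [∀ x, AddCommGroup (B x)] [∀ x, Module ℝ (B x)]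
    [∀ x, TopologicalSpace (B x)] : M → Type _ :=
  fun x => B x →L[ℝ] Bundle.Trivial M ℝ x

/-- The phase space `Φ(B) = B ⊕ B*`, with typical fibre `F × (F →L[ℝ] ℝ)`. -/
abbrev Phase {M : Type*} (B : M → Type*) [∀ x, AddCommGroup (B x)] [∀ x, Module ℝ (B x)]
    [∀ x, TopologicalSpace (B x)] : M → Type _ :=
  B ×ᵇ Dual B

variable {E : Type*} [NormedAddCommGroup E] [NormedSpace ℝ E]
  {M : Type*} [TopologicalSpace M] [ChartedSpace E M] [IsManifold 𝓘(ℝ, E) ∞ M]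
  {F : Type*} [NormedAddCommGroup F] [NormedSpace ℝ F]
  {B : M → Type*} [∀ x, AddCommGroup (B x)] [∀ x, Module ℝ (B x)] [∀ x, TopologicalSpace (B x)]
  [TopologicalSpace (TotalSpace F B)] [FiberBundle F B] [VectorBundle ℝ F B]

/-- The pairing `⟨u + α, v + β⟩₀ = α(v) + β(u)` on `Φ(B)`. -/
def phaseMetric (x : M) : Phase B x →ₗ[ℝ] Phase B x →ₗ[ℝ] ℝ :=
  LinearMap.mk₂ ℝ (fun v w => v.2 w.1 + w.2 v.1)
    (fun v v' w => by simp only [Prod.fst_add, Prod.snd_add, map_add, add_apply]; ring)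
    (fun r v w => by simp [mul_add])
    (fun v w w' => by simp only [Prod.fst_add, Prod.snd_add, map_add, add_apply]; ring)
    (fun r v w => by simp [mul_add])

/-- `K₀(u + α) = u - α` on `Φ(B)`. -/
def phaseK (x : M) : Phase B x →ₗ[ℝ] Phase B x :=
  LinearMap.prodMap LinearMap.id (-LinearMap.id)

/-- The anchor `ρ₀ ⊕ ρ₁` of `Φ(B)`, sending `u + α` to `ρ₀(u) + ρ₁(α)`. -/
def phaseAnchor (ρ₀ : ∀ x, B x →ₗ[ℝ] TangentSpace 𝓘(ℝ, E) x)
    (ρ₁ : ∀ x, Dual B x →ₗ[ℝ] TangentSpace 𝓘(ℝ, E) x) (x : M) :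
    Phase B x →ₗ[ℝ] TangentSpace 𝓘(ℝ, E) x :=
  (ρ₀ x).coprod (ρ₁ x)

variable [ContMDiffVectorBundle ∞ F B 𝓘(ℝ, E)]

/-- The section `X + α` of `Φ(B)`. -/
def pair (X : Sec E F B) (α : Sec E (F →L[ℝ] ℝ) (Dual B)) :
    Sec E (F × (F →L[ℝ] ℝ)) (Phase B) :=
  ⟨fun x => (X x, α x), fun x => (Bundle.contMDiffAt_section x).2
    (((Bundle.contMDiffAt_section x).1 (X.contMDiff x)).prodMk_space
      ((Bundle.contMDiffAt_section x).1 (α.contMDiff x)))⟩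

/-- The `B`-component `X` of a section `X + α` of `Φ(B)`. -/
def fstSec (u : Sec E (F × (F →L[ℝ] ℝ)) (Phase B)) : Sec E F B :=
  ⟨fun x => (u x).1, fun x => (Bundle.contMDiffAt_section x).2
    (((ContinuousLinearMap.fst ℝ F (F →L[ℝ] ℝ)).contMDiff.contMDiffAt (x := _)).comp x
      ((Bundle.contMDiffAt_section x).1 (u.contMDiff x)))⟩

/-- The `B*`-component `α` of a section `X + α` of `Φ(B)`. -/
def sndSec (u : Sec E (F × (F →L[ℝ] ℝ)) (Phase B)) : Sec E (F →L[ℝ] ℝ) (Dual B) :=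
  ⟨fun x => (u x).2, fun x => (Bundle.contMDiffAt_section x).2
    (((ContinuousLinearMap.snd ℝ F (F →L[ℝ] ℝ)).contMDiff.contMDiffAt (x := _)).comp x
      ((Bundle.contMDiffAt_section x).1 (u.contMDiff x)))⟩

@[simp] theorem pair_apply (X : Sec E F B) (α : Sec E (F →L[ℝ] ℝ) (Dual B)) (x : M) :
    pair X α x = (X x, α x) := rfl

@[simp] theorem fstSec_apply (u : Sec E (F × (F →L[ℝ] ℝ)) (Phase B)) (x : M) :
    fstSec u x = (u x).1 := rfl

@[simp] theorem sndSec_apply (u : Sec E (F × (F →L[ℝ] ℝ)) (Phase B)) (x : M) :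
    sndSec u x = (u x).2 := rfl

theorem contMDiff_dual_apply (α : Sec E (F →L[ℝ] ℝ) (Dual B)) (X : Sec E F B) :
    ContMDiff 𝓘(ℝ, E) 𝓘(ℝ, ℝ) ∞ (fun x => α x (X x)) := by
  have h := ContMDiff.clm_bundle_apply (E₂ := Bundle.Trivial M ℝ) α.contMDiff X.contMDiff
  exact fun x => (Bundle.contMDiffAt_section x).1 (h x)

variable [FiniteDimensional ℝ E] [T2Space M] [FiniteDimensional ℝ F]

/-- Evaluation `B*_x × B_x → ℝ`. -/
def evalDual (x : M) : Dual B x →ₗ[ℝ] B x →ₗ[ℝ] ℝ :=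
  LinearMap.mk₂ ℝ (fun α v => α v) (fun _ _ _ => rfl) (fun _ _ _ => rfl)
    (fun α _ _ => map_add α _ _) (fun r α v => map_smul α r v)

theorem evalDual_bijective (F : Type*) [NormedAddCommGroup F] [NormedSpace ℝ F]
    [FiniteDimensional ℝ F] {M : Type*} [TopologicalSpace M]
    {B : M → Type*} [∀ x, AddCommGroup (B x)] [∀ x, Module ℝ (B x)]
    [∀ x, TopologicalSpace (B x)]
    [TopologicalSpace (TotalSpace F B)] [FiberBundle F B] [VectorBundle ℝ F B] (x : M) :
    Function.Bijective (evalDual (B := B) x) := by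
  refine ⟨fun α β h => ContinuousLinearMap.ext fun v => LinearMap.congr_fun h v, fun f => ?_⟩
  let e := (trivializationAt F B x).continuousLinearEquivAt ℝ x
    (mem_baseSet_trivializationAt F B x)
  let h : F →L[ℝ] ℝ := LinearMap.toContinuousLinearMap (f ∘ₗ e.symm.toLinearEquiv.toLinearMap)
  refine ⟨h.comp e.toContinuousLinearMap, LinearMap.ext fun v => ?_⟩
  show f (e.symm (e v)) = f v
  rw [e.symm_apply_apply]

theorem evalDual_flip_bijective (F : Type*) [NormedAddCommGroup F] [NormedSpace ℝ F]
    [FiniteDimensional ℝ F] {M : Type*} [TopologicalSpace M]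
    {B : M → Type*} [∀ x, AddCommGroup (B x)] [∀ x, Module ℝ (B x)]
    [∀ x, TopologicalSpace (B x)]
    [TopologicalSpace (TotalSpace F B)] [FiberBundle F B] [VectorBundle ℝ F B] (x : M) :
    Function.Bijective (evalDual (B := B) x).flip := by
  have := finiteDimensional_fibre F (A := B) x
  let e : Dual B x ≃ₗ[ℝ] Module.Dual ℝ (B x) :=
    LinearEquiv.ofBijective (evalDual (B := B) x) (evalDual_bijective F x)
  have h : ((evalDual (B := B) x).flip : B x → (Dual B x →ₗ[ℝ] ℝ)) =
      ((Module.evalEquiv ℝ (B x)).trans e.dualMap : B x → Module.Dual ℝ (Dual B x)) := by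
    funext v
    rfl
  rw [h]
  exact LinearEquiv.bijective _

theorem exists_dualProduct {ρ : ∀ x, B x →ₗ[ℝ] TangentSpace 𝓘(ℝ, E) x}
    {S : Sec E F B → Sec E F B → Sec E F B} (hS : IsRightAnchoredProduct ρ S)
    (a : Sec E F B) (α : Sec E (F →L[ℝ] ℝ) (Dual B)) :
    ∃ β : Sec E (F →L[ℝ] ℝ) (Dual B), ∀ (s : Sec E F B) x,
      β x (s x) = anchorDeriv ρ a (fun y => α y (s y)) x - α x (S a s x) := by
  refine exists_sec_of_tensorial evalDual (evalDual_bijective F) contMDiff_dual_apply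
    (fun s x => anchorDeriv ρ a (fun y => α y (s y)) x - α x (S a s x)) (fun s => ?_)
    (fun s t x => ?_) (fun f s x => ?_)
  · exact (contMDiff_mvfderiv_apply hS.smooth_anchor a (contMDiff_dual_apply α s)).sub
      (contMDiff_dual_apply α _)
  · simp only [ContMDiffSection.coe_add, Pi.add_apply, map_add, hS.add_right,
      anchorDeriv_add (contMDiff_dual_apply α s) (contMDiff_dual_apply α t)]
    ring
  · simp only [fun_smul_apply, map_smul, smul_eq_mul, map_add, hS.fun_smul_right,
      anchorDeriv_mul f.contMDiff (contMDiff_dual_apply α s)]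
    ring

/-- The dual `S*` of a right-anchored product `S` on `B`, acting on sections of `B*`:
`⟨S*_a α, s⟩ = ρ(a).⟨α, s⟩ - ⟨α, S_a s⟩`. -/
def dualProduct {ρ : ∀ x, B x →ₗ[ℝ] TangentSpace 𝓘(ℝ, E) x}
    {S : Sec E F B → Sec E F B → Sec E F B} (hS : IsRightAnchoredProduct ρ S)
    (a : Sec E F B) (α : Sec E (F →L[ℝ] ℝ) (Dual B)) : Sec E (F →L[ℝ] ℝ) (Dual B) :=
  Classical.choose (exists_dualProduct hS a α)

theorem dualProduct_spec {ρ : ∀ x, B x →ₗ[ℝ] TangentSpace 𝓘(ℝ, E) x}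
    {S : Sec E F B → Sec E F B → Sec E F B} (hS : IsRightAnchoredProduct ρ S)
    (a : Sec E F B) (α : Sec E (F →L[ℝ] ℝ) (Dual B)) (s : Sec E F B) (x : M) :
    dualProduct hS a α x (s x) = anchorDeriv ρ a (fun y => α y (s y)) x - α x (S a s x) :=
  Classical.choose_spec (exists_dualProduct hS a α) s x

theorem exists_bidualProduct {ρ : ∀ x, Dual B x →ₗ[ℝ] TangentSpace 𝓘(ℝ, E) x}
    {T : Sec E (F →L[ℝ] ℝ) (Dual B) → Sec E (F →L[ℝ] ℝ) (Dual B) → Sec E (F →L[ℝ] ℝ) (Dual B)}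
    (hT : IsRightAnchoredProduct ρ T) (α : Sec E (F →L[ℝ] ℝ) (Dual B)) (X : Sec E F B) :
    ∃ Y : Sec E F B, ∀ (β : Sec E (F →L[ℝ] ℝ) (Dual B)) x,
      β x (Y x) = anchorDeriv ρ α (fun y => β y (X y)) x - T α β x (X x) := by
  refine exists_sec_of_tensorial (fun x => (evalDual x).flip) (evalDual_flip_bijective F)
    (fun Y β => contMDiff_dual_apply β Y)
    (fun β x => anchorDeriv ρ α (fun y => β y (X y)) x - T α β x (X x)) (fun β => ?_)
    (fun β γ x => ?_) (fun f β x => ?_)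
  · exact (contMDiff_mvfderiv_apply hT.smooth_anchor α (contMDiff_dual_apply β X)).sub
      (contMDiff_dual_apply _ X)
  · simp only [ContMDiffSection.coe_add, Pi.add_apply, add_apply, hT.add_right,
      anchorDeriv_add (contMDiff_dual_apply β X) (contMDiff_dual_apply γ X)]
    ring
  · simp only [fun_smul_apply, smul_apply, smul_eq_mul, add_apply, hT.fun_smul_right,
      anchorDeriv_mul f.contMDiff (contMDiff_dual_apply β X)]
    ring

/-- The dual `T*` of a right-anchored product `T` on `B*`, acting on sections of `B = B**`:
`⟨β, T*_α X⟩ = ρ(α).⟨β, X⟩ - ⟨T_α β, X⟩`. -/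
def bidualProduct {ρ : ∀ x, Dual B x →ₗ[ℝ] TangentSpace 𝓘(ℝ, E) x}
    {T : Sec E (F →L[ℝ] ℝ) (Dual B) → Sec E (F →L[ℝ] ℝ) (Dual B) → Sec E (F →L[ℝ] ℝ) (Dual B)}
    (hT : IsRightAnchoredProduct ρ T) (α : Sec E (F →L[ℝ] ℝ) (Dual B)) (X : Sec E F B) :
    Sec E F B :=
  Classical.choose (exists_bidualProduct hT α X)

theorem bidualProduct_spec {ρ : ∀ x, Dual B x →ₗ[ℝ] TangentSpace 𝓘(ℝ, E) x}
    {T : Sec E (F →L[ℝ] ℝ) (Dual B) → Sec E (F →L[ℝ] ℝ) (Dual B) → Sec E (F →L[ℝ] ℝ) (Dual B)}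
    (hT : IsRightAnchoredProduct ρ T) (α : Sec E (F →L[ℝ] ℝ) (Dual B)) (X : Sec E F B)
    (β : Sec E (F →L[ℝ] ℝ) (Dual B)) (x : M) :
    β x (bidualProduct hT α X x) =
      anchorDeriv ρ α (fun y => β y (X y)) x - T α β x (X x) :=
  Classical.choose_spec (exists_bidualProduct hT α X) β x

section Extension

variable {ρ₀ : ∀ x, B x →ₗ[ℝ] TangentSpace 𝓘(ℝ, E) x} {S : Sec E F B → Sec E F B → Sec E F B}
  {ρ₁ : ∀ x, Dual B x →ₗ[ℝ] TangentSpace 𝓘(ℝ, E) x}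
  {T : Sec E (F →L[ℝ] ℝ) (Dual B) → Sec E (F →L[ℝ] ℝ) (Dual B) → Sec E (F →L[ℝ] ℝ) (Dual B)}

/-- The product `∇_{X+α} (Y+β) = S_X Y + T*_α Y + S*_X β + T_α β` on `Γ(Φ(B))`. -/
def phaseProduct (hS : IsRightAnchoredProduct ρ₀ S) (hT : IsRightAnchoredProduct ρ₁ T)
    (u v : Sec E (F × (F →L[ℝ] ℝ)) (Phase B)) : Sec E (F × (F →L[ℝ] ℝ)) (Phase B) :=
  pair (S (fstSec u) (fstSec v) + bidualProduct hT (sndSec u) (fstSec v))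
    (dualProduct hS (fstSec u) (sndSec v) + T (sndSec u) (sndSec v))

/-- The bracket `[X+α, Y+β]_φ = [X,Y]_B + [α,β]_{B*} + T*_α Y - T*_β X + S*_X β - S*_Y α` on
`Γ(Φ(B))`. -/
def phaseBracket (hS : IsRightAnchoredProduct ρ₀ S) (hT : IsRightAnchoredProduct ρ₁ T)
    (u v : Sec E (F × (F →L[ℝ] ℝ)) (Phase B)) : Sec E (F × (F →L[ℝ] ℝ)) (Phase B) :=
  pair
    (prodBracket S (fstSec u) (fstSec v) + bidualProduct hT (sndSec u) (fstSec v)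
      - bidualProduct hT (sndSec v) (fstSec u))
    (prodBracket T (sndSec u) (sndSec v) + dualProduct hS (fstSec u) (sndSec v)
      - dualProduct hS (fstSec v) (sndSec u))

/-- Two products `S` on `B` and `T` on `B*` are Lie-extendible (compatible) if the curvature `R^∇`
of `∇ = phaseProduct` satisfies `R^∇(X, α) Y = R^∇(Y, α) X` and `R^∇(α, X) β = R^∇(β, X) α`. -/
structure IsLieExtendible (hS : IsRightAnchoredProduct ρ₀ S)
    (hT : IsRightAnchoredProduct ρ₁ T) : Prop where
  left : ∀ (X Y : Sec E F B) (α : Sec E (F →L[ℝ] ℝ) (Dual B)),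
    curvature (phaseProduct hS hT) (pair X 0) (pair 0 α) (pair Y 0) =
      curvature (phaseProduct hS hT) (pair Y 0) (pair 0 α) (pair X 0)
  right : ∀ (X : Sec E F B) (α β : Sec E (F →L[ℝ] ℝ) (Dual B)),
    curvature (phaseProduct hS hT) (pair 0 α) (pair X 0) (pair 0 β) =
      curvature (phaseProduct hS hT) (pair 0 β) (pair X 0) (pair 0 α)

end Extension

end PhaseSpace

end ParaKahler

end

universe uE uM uF uA

/-!
A para-Kähler structure is determined by its Levi-Civita connection `∇`: the bracket is
`[a, b] = ∇_a b - ∇_b a`, and the Jacobi identity for this bracket is the first Bianchi identity for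
the curvature of `∇`. So both directions are statements about metric right-anchored products that
satisfy the Bianchi identity (`IsLeviCivitaProduct`) and preserve `K`.

On `B ⊕ B*` the metric products preserving `K₀` are exactly the phase products: such a product
preserves `B` and `B*`, restricts to `S` and `T` there, and metricity forces its mixed parts to be
the duals `S*` and `T*`. For two flat products the cyclic sum of the curvature vanishes on triples
from `B` and on triples from `B*`, since `S` and `T` are flat; on two sections of `B` and one of
`B*` (or conversely) one of its three terms vanishes since `S*` (or `T*`) is flat, and the vanishing
of the other two together is Lie-extendibility (`isLeviCivitaProduct_phaseProduct`). Flatness of the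
duals uses that the anchor is a morphism of brackets, which holds at every point with nonzero
fibre (`anchor_commutator_smul`).

For the converse, the Bianchi identity and metricity give the pair symmetry
`⟨R(a, b) c, d⟩ = ⟨R(c, d) a, b⟩` of the curvature (`curvature_pair_symm`). For `X, Y, Z` in `B` and
`γ` in `B*` the number `⟨R(X, Y) Z, γ⟩ = ⟨R(Z, γ) X, Y⟩` is zero, because `R(Z, γ)` preserves `B`
and `B` is isotropic; so `S`, and likewise `T`, is flat
(`IsLeviCivitaProduct.exists_eq_phaseProduct`).

It remains to identify a para-Kähler Lie algebroid `A` with some `B ⊕ B*` as a bundle. Here `B` is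
the `+1`-eigenbundle of `K`, which has half the rank of `A` and becomes a smooth bundle through local
frames of global sections (`exists_subbundle`); the metric identifies the `-1`-eigenbundle with `B*`
(`exists_prod_dual_equiv`, `IsParaKahler.exists_phase`). Smoothness of all bundle maps is reduced to
smoothness on global sections (`isSmoothHom_of_sec`).
-/

noncomputable section

namespace ParaKahler

/-! ### Smooth bundle maps and subbundles -/

section Subbundles

variable {E : Type*} [NormedAddCommGroup E] [NormedSpace ℝ E] [FiniteDimensional ℝ E]
  {M : Type*} [TopologicalSpace M] [ChartedSpace E M] [IsManifold 𝓘(ℝ, E) ∞ M] [T2Space M]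
  {F : Type*} [NormedAddCommGroup F] [NormedSpace ℝ F] [FiniteDimensional ℝ F]
  {A : M → Type*} [∀ x, AddCommGroup (A x)] [∀ x, Module ℝ (A x)] [∀ x, TopologicalSpace (A x)]
  [TopologicalSpace (TotalSpace F A)] [FiberBundle F A] [VectorBundle ℝ F A]
  [ContMDiffVectorBundle ∞ F A 𝓘(ℝ, E)]
  {F' : Type*} [NormedAddCommGroup F'] [NormedSpace ℝ F']
  {A' : M → Type*} [∀ x, AddCommGroup (A' x)] [∀ x, Module ℝ (A' x)]
  [∀ x, TopologicalSpace (A' x)]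
  [TopologicalSpace (TotalSpace F' A')] [FiberBundle F' A'] [VectorBundle ℝ F' A']
  [ContMDiffVectorBundle ∞ F' A' 𝓘(ℝ, E)]

/-- A fibrewise linear map is a morphism of smooth vector bundles as soon as it maps global smooth
sections to smooth sections: near a point, cut-offs of a local frame are global sections. -/
theorem isSmoothHom_of_sec (H : ∀ x, A x →ₗ[ℝ] A' x)
    (h : ∀ s : Sec E F A, ContMDiff 𝓘(ℝ, E) (𝓘(ℝ, E).prod 𝓘(ℝ, F')) ∞
      (fun x => (⟨x, H x (s x)⟩ : TotalSpace F' A'))) : IsSmoothHom E F F' H := by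
  intro v₀
  set x₀ := v₀.proj
  let t := trivializationAt F A x₀
  let t' := trivializationAt F' A' x₀
  let b := Module.finBasis ℝ F
  have hx₀ : x₀ ∈ t.baseSet := mem_baseSet_trivializationAt F A x₀
  have hx₀' : x₀ ∈ t'.baseSet := mem_baseSet_trivializationAt F' A' x₀
  obtain ⟨f, hf⟩ : ∃ f : SmoothBumpFunction 𝓘(ℝ, E) x₀, tsupport f ⊆ t.baseSet := by
    obtain ⟨f, hf, -⟩ := ((SmoothBumpFunction.nhds_basis_support (I := 𝓘(ℝ, E))
      (t.open_baseSet.mem_nhds hx₀))).mem_iff.1 (t.open_baseSet.mem_nhds hx₀)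
    exact ⟨f, hf⟩
  have : ContMDiffVectorBundle 1 F A 𝓘(ℝ, E) := ContMDiffVectorBundle.of_le (n := ∞) (by simp)
  let e : Fin (Module.finrank ℝ F) → Sec E F A := fun i => ⟨fun x => f x • t.localFrame b i x,
    ContMDiffOn.smul_section_of_tsupport f.contMDiff.contMDiffOn t.open_baseSet hf
      (t.contMDiffOn_localFrame_baseSet ∞ b i)⟩
  have hproj : ContMDiffAt (𝓘(ℝ, E).prod 𝓘(ℝ, F)) 𝓘(ℝ, E) ∞ (TotalSpace.proj : TotalSpace F A → M)
    v₀ := (contMDiff_proj A).contMDiffAt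
  rw [contMDiffAt_totalSpace]
  refine ⟨hproj, ?_⟩
  have hcoord : ContMDiffAt (𝓘(ℝ, E).prod 𝓘(ℝ, F)) 𝓘(ℝ, F) ∞
      (fun v : TotalSpace F A => (t v).2) v₀ :=
    ((contMDiffAt_totalSpace (F := F) (E := A) (IB := 𝓘(ℝ, E)) (n := ∞)).1
      (contMDiffAt_id (x := v₀))).2
  have hsum : ContMDiffAt (𝓘(ℝ, E).prod 𝓘(ℝ, F)) 𝓘(ℝ, F') ∞
      (fun v : TotalSpace F A => ∑ i, b.repr (t v).2 i • (t' ⟨v.proj, H v.proj (e i v.proj)⟩).2)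
      v₀ := by
    refine contMDiffAt_finsetSum fun i _ => ?_
    have h1 : ContMDiffAt (𝓘(ℝ, E).prod 𝓘(ℝ, F)) 𝓘(ℝ, ℝ) ∞
        (fun v : TotalSpace F A => b.repr (t v).2 i) v₀ :=
      ((LinearMap.toContinuousLinearMap (b.coord i)).contMDiff.contMDiffAt (x := _)).comp v₀ hcoord
    have h2 : ContMDiffAt (𝓘(ℝ, E).prod 𝓘(ℝ, F)) 𝓘(ℝ, F') ∞
        (fun v : TotalSpace F A => (t' ⟨v.proj, H v.proj (e i v.proj)⟩).2) v₀ :=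
      ContMDiffAt.comp (g := fun x => (t' ⟨x, H x (e i x)⟩).2) v₀
        ((contMDiffAt_section x₀).1 (h (e i) x₀)) hproj
    exact h1.smul h2
  refine hsum.congr_of_eventuallyEq ?_
  have hev : ∀ᶠ x in 𝓝 x₀, f x = 1 ∧ x ∈ t.baseSet ∧ x ∈ t'.baseSet :=
    f.eventuallyEq_one.and ((t.open_baseSet.eventually_mem hx₀).and
      (t'.open_baseSet.eventually_mem hx₀'))
  filter_upwards [(FiberBundle.continuous_proj F A).continuousAt.eventually hev] with v hv
  obtain ⟨h1, hv, hv'⟩ := hv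
  have hvv : v.snd = ∑ i, b.repr (t v).2 i • e i v.proj := by
    have hin : v.snd = t.symm v.proj (t v).2 := (t.symm_apply_apply_mk hv v.snd).symm
    conv_lhs => rw [hin, ← b.sum_repr (t v).2]
    rw [← t.symmL_apply (R := ℝ) hv, map_sum]
    refine Finset.sum_congr rfl fun i _ => ?_
    rw [map_smul]
    congr 1
    simp only [e, ContMDiffSection.coeFn_mk, h1, one_smul]
    rw [t.localFrame_apply_of_mem_baseSet b hv]
    simp [Trivialization.basisAt, t.symmL_apply (R := ℝ) hv]
  have hl : ∀ w : A' v.proj, (t' ⟨v.proj, w⟩).2 = t'.linearMapAt ℝ v.proj w := fun w => by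
    rw [t'.linearMapAt_apply, if_pos hv']
  show (t' ⟨v.proj, H v.proj v.snd⟩).2 = _
  simp only [hl]
  conv_lhs => rw [hvv]
  simp only [map_sum, map_smul]

/-- A family `W` of subspaces of the fibres of `A`, of constant rank `n` and spanned by global
sections, has local frames `e` of smooth sections with smooth coordinates `c`. -/
theorem exists_subbundle_frame (n : ℕ) (W : ∀ x, Submodule ℝ (A x))
    (hn : ∀ x, Module.finrank ℝ (W x) = n)
    (hW : ∀ x₀, ∀ v ∈ W x₀, ∃ s : Sec E F A, (∀ x, s x ∈ W x) ∧ s x₀ = v) (x₀ : M) :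
    ∃ (U : Set M) (e : Fin n → Sec E F A) (c : ∀ x, A x →ₗ[ℝ] EuclideanSpace ℝ (Fin n)),
      IsOpen U ∧ x₀ ∈ U ∧ (∀ i x, e i x ∈ W x) ∧
      (∀ x ∈ U, ∀ w : EuclideanSpace ℝ (Fin n), c x (∑ i, w i • e i x) = w) ∧
      (∀ x ∈ U, ∀ v ∈ W x, ∑ i, c x v i • e i x = v) ∧
      ∀ (s : ∀ x, A x), ∀ x ∈ U, ContMDiffAt 𝓘(ℝ, E) (𝓘(ℝ, E).prod 𝓘(ℝ, F)) ∞
          (fun x => (⟨x, s x⟩ : TotalSpace F A)) x →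
        ContMDiffAt 𝓘(ℝ, E) 𝓘(ℝ, EuclideanSpace ℝ (Fin n)) ∞ (fun x => c x (s x)) x := by
  classical
  let V := EuclideanSpace ℝ (Fin n)
  let t := trivializationAt F A x₀
  have hx₀ : x₀ ∈ t.baseSet := mem_baseSet_trivializationAt F A x₀
  have hfd : ∀ x, FiniteDimensional ℝ (A x) := fun x => finiteDimensional_fibre F x
  let b := Module.finBasisOfFinrankEq ℝ (W x₀) (hn x₀)
  choose e heW he₀ using fun i => hW x₀ (b i) (b i).2
  -- `N x` is the frame `e` read in the trivialization `t`, and `Q` is a left inverse of `N x₀`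
  let N : M → V →L[ℝ] F := fun x => ∑ i, (EuclideanSpace.proj i : V →L[ℝ] ℝ).smulRight
    (t ⟨x, e i x⟩).2
  have hNapply : ∀ x ∈ t.baseSet, ∀ w : V, N x w = t.linearMapAt ℝ x (∑ i, w i • e i x) := by
    intro x hx w
    simp only [N, map_sum, map_smul, sum_apply, ContinuousLinearMap.smulRight_apply]
    simp only [t.linearMapAt_apply, if_pos hx]
    rfl
  have hinj : LinearMap.ker (N x₀).toLinearMap = ⊥ := by
    rw [LinearMap.ker_eq_bot']
    intro w hw
    have h1 : t.linearMapAt ℝ x₀ (∑ i, w i • e i x₀) = 0 := (hNapply x₀ hx₀ w).symm.trans hw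
    have h2 : ∑ i, w i • e i x₀ = 0 := by
      rw [← t.symmₗ_linearMapAt (R := ℝ) hx₀ (∑ i, w i • e i x₀), h1, map_zero]
    have h3 : ∑ i, w i • b i = 0 := by
      apply Subtype.ext
      simpa [he₀] using h2
    ext i
    exact Fintype.linearIndependent_iff.1 b.linearIndependent _ h3 i
  obtain ⟨Q₀, hQ₀⟩ := LinearMap.exists_leftInverse_of_injective _ hinj
  let Q : F →L[ℝ] V := LinearMap.toContinuousLinearMap Q₀
  have hN : ∀ x ∈ t.baseSet, ContMDiffAt 𝓘(ℝ, E) 𝓘(ℝ, V →L[ℝ] F) ∞ N x := by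
    intro x hx
    refine contMDiffAt_finsetSum fun i _ => ?_
    have h1 : ContMDiffAt 𝓘(ℝ, E) 𝓘(ℝ, F) ∞ (fun x => (t ⟨x, e i x⟩).2) x :=
      (t.contMDiffAt_section_iff hx).1 (e i).contMDiff.contMDiffAt
    exact ((ContinuousLinearMap.smulRightL ℝ V F
      (EuclideanSpace.proj i : V →L[ℝ] ℝ)).contMDiff.contMDiffAt (x := _)).comp x h1
  let G : M → V →L[ℝ] V := fun x => Q.comp (N x)
  have hG : ∀ x ∈ t.baseSet, ContMDiffAt 𝓘(ℝ, E) 𝓘(ℝ, V →L[ℝ] V) ∞ G x := fun x hx =>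
    ((ContinuousLinearMap.compL ℝ V F V Q).contMDiff.contMDiffAt (x := _)).comp x (hN x hx)
  have hGon : ContinuousOn G t.baseSet := fun x hx => (hG x hx).continuousAt.continuousWithinAt
  have hG₀ : G x₀ = 1 := by
    ext1 w
    exact LinearMap.congr_fun hQ₀ w
  have hc₁ : ∀ x, x ∈ t.baseSet → IsUnit (G x) → ∀ w : V,
      Ring.inverse (G x) (Q (t.linearMapAt ℝ x (∑ i, w i • e i x))) = w := by
    intro x hx hu w
    rw [← hNapply x hx w]
    exact DFunLike.congr_fun (Ring.inverse_mul_cancel (G x) hu) w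
  refine ⟨t.baseSet ∩ G ⁻¹' {g | IsUnit g}, e,
    fun x => (Ring.inverse (G x)).toLinearMap ∘ₗ Q.toLinearMap ∘ₗ t.linearMapAt ℝ x,
    hGon.isOpen_inter_preimage t.open_baseSet Units.isOpen, ⟨hx₀, ?_⟩, heW,
    fun x hx w => hc₁ x hx.1 hx.2 w, ?_, ?_⟩
  · show IsUnit (G x₀)
    rw [hG₀]; exact isUnit_one
  · intro x hx v hv
    let J : V →ₗ[ℝ] W x := ∑ i, (EuclideanSpace.proj i : V →L[ℝ] ℝ).toLinearMap.smulRight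
      (⟨e i x, heW i x⟩ : W x)
    have hJ : ∀ w : V, (J w : A x) = ∑ i, w i • e i x := fun w => by
      simp only [J, LinearMap.sum_apply, LinearMap.smulRight_apply, Submodule.coe_sum,
        Submodule.coe_smul]
      rfl
    have hJinj : Function.Injective J := by
      intro w w' h
      rw [← hc₁ x hx.1 hx.2 w, ← hc₁ x hx.1 hx.2 w', ← hJ, ← hJ, h]
    have hJsurj : Function.Surjective J :=
      (LinearMap.injective_iff_surjective_of_finrank_eq_finrank (by simp [hn x, V])).1 hJinj
    obtain ⟨w, hw⟩ := hJsurj ⟨v, hv⟩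
    have hv' : v = ∑ i, w i • e i x := by rw [← hJ, hw]
    have h1 := hc₁ x hx.1 hx.2 w
    rw [← hv'] at h1
    simp only [LinearMap.comp_apply, ContinuousLinearMap.coe_coe]
    rw [h1, hv']
  · intro s x hx hs
    have h1 : ContMDiffAt 𝓘(ℝ, E) 𝓘(ℝ, F) ∞ (fun x => (t ⟨x, s x⟩).2) x :=
      (t.contMDiffAt_section_iff hx.1).1 hs
    obtain ⟨u, hu⟩ := hx.2
    have h2 : ContMDiffAt 𝓘(ℝ, E) 𝓘(ℝ, V →L[ℝ] V) ∞ (fun x => Ring.inverse (G x)) x := by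
      have h3 := contDiffAt_ringInverse ℝ (n := ∞) u
      rw [hu] at h3
      exact h3.contMDiffAt.comp x (hG x hx.1)
    refine (h2.clm_apply ((Q.contMDiff.contMDiffAt (x := _)).comp x h1)).congr_of_eventuallyEq ?_
    filter_upwards [t.open_baseSet.mem_nhds hx.1] with y hy
    simp [t.linearMapAt_apply, if_pos hy]

end Subbundles

section SubbundleStructure

variable {E : Type*} [NormedAddCommGroup E] [NormedSpace ℝ E] [FiniteDimensional ℝ E]
  {M : Type*} [TopologicalSpace M] [ChartedSpace E M] [IsManifold 𝓘(ℝ, E) ∞ M] [T2Space M]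
  {F : Type*} [NormedAddCommGroup F] [NormedSpace ℝ F] [FiniteDimensional ℝ F]
  {A : M → Type*} [∀ x, AddCommGroup (A x)] [∀ x, Module ℝ (A x)] [∀ x, TopologicalSpace (A x)]
  [TopologicalSpace (TotalSpace F A)] [FiberBundle F A] [VectorBundle ℝ F A]
  [ContMDiffVectorBundle ∞ F A 𝓘(ℝ, E)]
  {B : M → Type*} [∀ x, AddCommGroup (B x)] [∀ x, Module ℝ (B x)]

variable (E F) in
/-- A local frame `ε` over an open set `U` of a family `B` of vector spaces included by `ι` in the
fibres of `A`, with coordinates given by the restriction of `c : A → ℝⁿ`. Smoothness is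
measured in `A`. -/
structure SubbundleFrame (n : ℕ) (ι : ∀ x, B x →ₗ[ℝ] A x) where
  /-- The domain of the frame. -/
  U : Set M
  /-- The frame. -/
  ε : Fin n → ∀ x, B x
  /-- The coordinates, extended to the fibres of `A`. -/
  c : ∀ x, A x →ₗ[ℝ] EuclideanSpace ℝ (Fin n)
  isOpen : IsOpen U
  coord_sum : ∀ x ∈ U, ∀ w : EuclideanSpace ℝ (Fin n), c x (ι x (∑ i, w i • ε i x)) = w
  sum_coord : ∀ x ∈ U, ∀ v : B x, ∑ i, c x (ι x v) i • ε i x = v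
  smooth_frame : ∀ i, ContMDiff 𝓘(ℝ, E) (𝓘(ℝ, E).prod 𝓘(ℝ, F)) ∞
    (fun x => (⟨x, ι x (ε i x)⟩ : TotalSpace F A))
  smooth_coord : ∀ (s : ∀ x, A x), ∀ x ∈ U, ContMDiffAt 𝓘(ℝ, E) (𝓘(ℝ, E).prod 𝓘(ℝ, F)) ∞
      (fun x => (⟨x, s x⟩ : TotalSpace F A)) x →
    ContMDiffAt 𝓘(ℝ, E) 𝓘(ℝ, EuclideanSpace ℝ (Fin n)) ∞ (fun x => c x (s x)) x

namespace SubbundleFrame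

variable {n : ℕ} {ι : ∀ x, B x →ₗ[ℝ] A x} (Q Q' : SubbundleFrame E F n ι)

/-- The local trivialization of `B` given by a frame. -/
def pretrivialization : Pretrivialization (EuclideanSpace ℝ (Fin n))
    (π (EuclideanSpace ℝ (Fin n)) B) where
  toFun v := (v.1, Q.c v.1 (ι v.1 v.2))
  invFun p := ⟨p.1, ∑ i, p.2 i • Q.ε i p.1⟩
  source := π (EuclideanSpace ℝ (Fin n)) B ⁻¹' Q.U
  target := Q.U ×ˢ univ
  map_source' v hv := ⟨hv, mem_univ _⟩
  map_target' p hp := hp.1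
  left_inv' := by
    rintro ⟨x, v⟩ hv
    exact congrArg _ (Q.sum_coord x hv v)
  right_inv' := by
    rintro ⟨x, w⟩ hp
    exact Prod.ext rfl (Q.coord_sum x hp.1 w)
  open_target := Q.isOpen.prod isOpen_univ
  baseSet := Q.U
  open_baseSet := Q.isOpen
  source_eq := rfl
  target_eq := rfl
  proj_toFun _ _ := rfl

theorem pretrivialization_symm {x : M} (hx : x ∈ Q.U) (w : EuclideanSpace ℝ (Fin n)) :
    Q.pretrivialization.symm x w = ∑ i, w i • Q.ε i x := by
  rw [Pretrivialization.symm_apply _ hx]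
  rfl

theorem exists_coordChange : ∃ f : M → EuclideanSpace ℝ (Fin n) →L[ℝ] EuclideanSpace ℝ (Fin n),
    ContMDiffOn 𝓘(ℝ, E) 𝓘(ℝ, EuclideanSpace ℝ (Fin n) →L[ℝ] EuclideanSpace ℝ (Fin n)) ∞ f
      (Q.U ∩ Q'.U) ∧
    ∀ x ∈ Q.U ∩ Q'.U, ∀ w, f x w = (Q'.pretrivialization ⟨x, Q.pretrivialization.symm x w⟩).2 := by
  let V := EuclideanSpace ℝ (Fin n)
  refine ⟨fun x => ∑ i, (EuclideanSpace.proj i : V →L[ℝ] ℝ).smulRight (Q'.c x (ι x (Q.ε i x))),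
    fun x hx => ContMDiffAt.contMDiffWithinAt ?_, fun x hx w => ?_⟩
  · refine contMDiffAt_finsetSum fun i _ => ?_
    exact ((ContinuousLinearMap.smulRightL ℝ V V
      (EuclideanSpace.proj i : V →L[ℝ] ℝ)).contMDiff.contMDiffAt (x := _)).comp x
      (Q'.smooth_coord _ x hx.2 (Q.smooth_frame i x))
  · rw [Q.pretrivialization_symm hx.1]
    show _ = Q'.c x (ι x (∑ i, w i • Q.ε i x))
    simp only [map_sum, map_smul, sum_apply, ContinuousLinearMap.smulRight_apply]
    rfl

end SubbundleFrame

/-- The smooth structure of a subbundle: a section of `B` is smooth if and only if it is smooth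
as a section of `A`. The fibres carry the topology of a trivialization. -/
theorem exists_subbundle (n : ℕ) (ι : ∀ x, B x →ₗ[ℝ] A x) (hι : ∀ x, Function.Injective (ι x))
    (hn : ∀ x, Module.finrank ℝ (B x) = n)
    (hW : ∀ x₀ (v : B x₀), ∃ s : Sec E F A, (∀ x, s x ∈ LinearMap.range (ι x)) ∧ s x₀ = ι x₀ v) :
    ∃ (_ : ∀ x, TopologicalSpace (B x))
      (_ : TopologicalSpace (TotalSpace (EuclideanSpace ℝ (Fin n)) B))
      (_ : FiberBundle (EuclideanSpace ℝ (Fin n)) B)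
      (_ : VectorBundle ℝ (EuclideanSpace ℝ (Fin n)) B)
      (_ : ContMDiffVectorBundle ∞ (EuclideanSpace ℝ (Fin n)) B 𝓘(ℝ, E)),
      ∀ s : ∀ x, B x,
        ContMDiff 𝓘(ℝ, E) (𝓘(ℝ, E).prod 𝓘(ℝ, EuclideanSpace ℝ (Fin n))) ∞
          (fun x => (⟨x, s x⟩ : TotalSpace (EuclideanSpace ℝ (Fin n)) B)) ↔
        ContMDiff 𝓘(ℝ, E) (𝓘(ℝ, E).prod 𝓘(ℝ, F)) ∞
          (fun x => (⟨x, ι x (s x)⟩ : TotalSpace F A)) := by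
  let V := EuclideanSpace ℝ (Fin n)
  have hQ : ∀ x₀, ∃ Q : SubbundleFrame E F n ι, x₀ ∈ Q.U := by
    intro x₀
    obtain ⟨U, e, c, hU, hx₀, he, h1, h2, h3⟩ := exists_subbundle_frame (E := E) (F := F) n
      (fun x => LinearMap.range (ι x))
      (fun x => by rw [LinearMap.finrank_range_of_inj (hι x), hn x])
      (by rintro x₀ _ ⟨v, rfl⟩; exact hW x₀ v) x₀
    choose ε hε using he
    refine ⟨⟨U, ε, c, hU, fun x hx w => ?_, fun x hx v => hι x ?_, fun i => ?_, h3⟩, hx₀⟩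
    · simpa only [map_sum, map_smul, hε] using h1 x hx w
    · simpa only [map_sum, map_smul, hε] using h2 x hx (ι x v) ⟨v, rfl⟩
    · simpa only [hε] using (e i).contMDiff
  choose Q hQ using hQ
  let τ : ∀ x, TopologicalSpace (B x) := fun x =>
    TopologicalSpace.induced (fun v => (Q x).pretrivialization (⟨x, v⟩ : TotalSpace V B))
      inferInstance
  let a : VectorPrebundle ℝ V B :=
    { pretrivializationAtlas := range fun x => (Q x).pretrivialization
      pretrivialization_linear' := by
        rintro _ ⟨x₀, rfl⟩
        exact ⟨fun x hx => ⟨((Q x₀).c x ∘ₗ ι x).map_add, ((Q x₀).c x ∘ₗ ι x).map_smul⟩⟩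
      pretrivializationAt := fun x => (Q x).pretrivialization
      mem_base_pretrivializationAt := hQ
      pretrivialization_mem_atlas := fun x => ⟨x, rfl⟩
      exists_coordChange := by
        rintro _ ⟨x, rfl⟩ _ ⟨y, rfl⟩
        obtain ⟨f, hf, hf'⟩ := (Q x).exists_coordChange (Q y)
        exact ⟨f, hf.continuousOn, hf'⟩
      totalSpaceMk_isInducing := fun x => ⟨rfl⟩ }
  have ha : a.IsContMDiff 𝓘(ℝ, E) ∞ := by
    constructor
    rintro _ ⟨x, rfl⟩ _ ⟨y, rfl⟩
    exact (Q x).exists_coordChange (Q y)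
  let := a.totalSpaceTopology
  let := a.toFiberBundle
  let := a.toVectorBundle
  refine ⟨τ, a.totalSpaceTopology, a.toFiberBundle, a.toVectorBundle,
    a.contMDiffVectorBundle 𝓘(ℝ, E), fun s => ?_⟩
  have hiff : ∀ x₀, ContMDiffAt 𝓘(ℝ, E) (𝓘(ℝ, E).prod 𝓘(ℝ, V)) ∞
      (fun x => (⟨x, s x⟩ : TotalSpace V B)) x₀ ↔
      ContMDiffAt 𝓘(ℝ, E) 𝓘(ℝ, V) ∞ (fun x => (Q x₀).c x (ι x (s x))) x₀ := fun x₀ =>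
    contMDiffAt_section x₀
  refine ⟨fun h x₀ => ?_, fun h x₀ => (hiff x₀).2 ((Q x₀).smooth_coord _ x₀ (hQ x₀) (h x₀))⟩
  have h1 := (hiff x₀).1 (h x₀)
  refine ContMDiffAt.congr_of_eventuallyEq
    (f := fun x => (⟨x, ∑ i, (Q x₀).c x (ι x (s x)) i • ι x ((Q x₀).ε i x)⟩ : TotalSpace F A)) ?_ ?_
  · refine ContMDiffAt.sum_section fun i _ => ContMDiffAt.smul_section ?_ ((Q x₀).smooth_frame i x₀)
    exact ((EuclideanSpace.proj i : V →L[ℝ] ℝ).contMDiff.contMDiffAt (x := _)).comp x₀ h1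
  · filter_upwards [(Q x₀).isOpen.mem_nhds (hQ x₀)] with x hx
    have h2 := congrArg (ι x) ((Q x₀).sum_coord x hx (s x))
    simp only [map_sum, map_smul] at h2
    rw [h2]

end SubbundleStructure

/-! ### Right-anchored products and their curvature -/

section Products

variable {E : Type*} [NormedAddCommGroup E] [NormedSpace ℝ E] [FiniteDimensional ℝ E]
  {M : Type*} [TopologicalSpace M] [ChartedSpace E M] [IsManifold 𝓘(ℝ, E) ∞ M] [T2Space M]
  {F : Type*} [NormedAddCommGroup F] [NormedSpace ℝ F] [FiniteDimensional ℝ F]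
  {A : M → Type*} [∀ x, AddCommGroup (A x)] [∀ x, Module ℝ (A x)] [∀ x, TopologicalSpace (A x)]
  [TopologicalSpace (TotalSpace F A)] [FiberBundle F A] [VectorBundle ℝ F A]
  [ContMDiffVectorBundle ∞ F A 𝓘(ℝ, E)]
  {F₁ : Type*} [NormedAddCommGroup F₁] [NormedSpace ℝ F₁]
  {A₁ : M → Type*} [∀ x, AddCommGroup (A₁ x)] [∀ x, Module ℝ (A₁ x)]
  [∀ x, TopologicalSpace (A₁ x)]
  [TopologicalSpace (TotalSpace F₁ A₁)] [FiberBundle F₁ A₁] [VectorBundle ℝ F₁ A₁]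
  {F₂ : Type*} [NormedAddCommGroup F₂] [NormedSpace ℝ F₂]
  {A₂ : M → Type*} [∀ x, AddCommGroup (A₂ x)] [∀ x, Module ℝ (A₂ x)]
  [∀ x, TopologicalSpace (A₂ x)]
  [TopologicalSpace (TotalSpace F₂ A₂)] [FiberBundle F₂ A₂] [VectorBundle ℝ F₂ A₂]
  {ρ : ∀ x, A x →ₗ[ℝ] TangentSpace 𝓘(ℝ, E) x}

theorem anchorDeriv_add_left (a b : Sec E F A) (f : M → ℝ) (x : M) :
    anchorDeriv ρ (a + b) f x = anchorDeriv ρ a f x + anchorDeriv ρ b f x := by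
  simp [anchorDeriv]

theorem anchorDeriv_fun_smul_left (h : Fun E M) (a : Sec E F A) (f : M → ℝ) (x : M) :
    anchorDeriv ρ (h • a) f x = h x * anchorDeriv ρ a f x := by
  simp [anchorDeriv]

theorem anchorDeriv_const (a : Sec E F A) (r : ℝ) (x : M) :
    anchorDeriv ρ a (fun _ => r) x = 0 := by
  simp [anchorDeriv, mvfderiv_const]

/-- The smooth function `ρ(a)(f)`. -/
def derivFun (hρ : IsSmoothHom E F E ρ) (a : Sec E F A) (f : Fun E M) : Fun E M :=
  ⟨anchorDeriv ρ a f, contMDiff_mvfderiv_apply hρ a f.contMDiff⟩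

@[simp] theorem derivFun_apply (hρ : IsSmoothHom E F E ρ) (a : Sec E F A) (f : Fun E M) (x : M) :
    derivFun hρ a f x = anchorDeriv ρ a f x := rfl

/-- `ℝ`-linearity is part of `C^∞(M)`-linearity and of the Leibniz rule. -/
theorem isRightAnchoredProduct_of_fun {D : Sec E F A → Sec E F A → Sec E F A}
    (hρ : IsSmoothHom E F E ρ)
    (h1 : ∀ a b c, D (a + b) c = D a c + D b c) (h2 : ∀ a b c, D a (b + c) = D a b + D a c)
    (h3 : ∀ (f : Fun E M) a b, D (f • a) b = f • D a b)
    (h4 : ∀ (f : Fun E M) a b x,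
      D a (f • b) x = f x • D a b x + anchorDeriv ρ a f x • b x) :
    IsRightAnchoredProduct ρ D where
  smooth_anchor := hρ
  add_left := h1
  add_right := h2
  smul_left r a b := h3 (ContMDiffMap.const r) a b
  smul_right r a b := by
    ext x
    have h := h4 (ContMDiffMap.const r) a b x
    have h0 : anchorDeriv ρ a (ContMDiffMap.const r : Fun E M) x = 0 := anchorDeriv_const a r x
    rw [h0, zero_smul, add_zero] at h
    exact h
  fun_smul_left := h3
  fun_smul_right := h4

namespace IsRightAnchoredProduct

variable {D : Sec E F A → Sec E F A → Sec E F A} (hD : IsRightAnchoredProduct ρ D)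
include hD

theorem zero_left (c : Sec E F A) : D 0 c = 0 := by
  have h := hD.smul_left 0 0 c
  rwa [zero_smul, zero_smul] at h

theorem zero_right (c : Sec E F A) : D c 0 = 0 := by
  have h := hD.smul_right 0 c 0
  rwa [zero_smul, zero_smul] at h

theorem neg_left (a c : Sec E F A) : D (-a) c = -D a c :=
  eq_neg_of_add_eq_zero_left (by rw [← hD.add_left, neg_add_cancel, hD.zero_left])

theorem neg_right (a c : Sec E F A) : D a (-c) = -D a c :=
  eq_neg_of_add_eq_zero_left (by rw [← hD.add_right, neg_add_cancel, hD.zero_right])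

theorem sub_left (a b c : Sec E F A) : D (a - b) c = D a c - D b c := by
  rw [sub_eq_add_neg, hD.add_left, hD.neg_left, sub_eq_add_neg]

theorem sub_right (a b c : Sec E F A) : D a (b - c) = D a b - D a c := by
  rw [sub_eq_add_neg, hD.add_right, hD.neg_right, sub_eq_add_neg]

theorem fun_smul_right_eq (f : Fun E M) (a b : Sec E F A) :
    D a (f • b) = f • D a b + derivFun hD.smooth_anchor a f • b := by
  ext x
  exact hD.fun_smul_right f a b x

theorem curvature_swap (a b c : Sec E F A) : curvature D a b c = -curvature D b a c := by
  simp only [curvature, prodBracket, hD.sub_left]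
  abel

theorem curvature_add_left (a b c d : Sec E F A) :
    curvature D (a + b) c d = curvature D a c d + curvature D b c d := by
  simp only [curvature, prodBracket, hD.sub_left, hD.add_left, hD.add_right]
  abel

theorem curvature_add_middle (a b c d : Sec E F A) :
    curvature D a (b + c) d = curvature D a b d + curvature D a c d := by
  simp only [curvature, prodBracket, hD.sub_left, hD.add_left, hD.add_right]
  abel

theorem curvature_add_right (a b c d : Sec E F A) :
    curvature D a b (c + d) = curvature D a b c + curvature D a b d := by
  simp only [curvature, hD.add_right]
  abel

theorem curvature_fun_smul_left (f : Fun E M) (a b c : Sec E F A) :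
    curvature D (f • a) b c = f • curvature D a b c := by
  ext x
  simp only [curvature, prodBracket, hD.sub_left, hD.fun_smul_right_eq, hD.add_left,
    hD.fun_smul_left, ContMDiffSection.coe_sub, ContMDiffSection.coe_add, Pi.sub_apply,
    Pi.add_apply, fun_smul_apply, derivFun_apply]
  module

theorem curvature_fun_smul_middle (f : Fun E M) (a b c : Sec E F A) :
    curvature D a (f • b) c = f • curvature D a b c := by
  rw [hD.curvature_swap, hD.curvature_fun_smul_left, hD.curvature_swap a b c]
  ext x
  simp

/-- The failure of `C^∞(M)`-linearity of the curvature in its last argument is the failure of the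
anchor to be a morphism of brackets. -/
theorem curvature_fun_smul_right (f : Fun E M) (a b c : Sec E F A) (x : M) :
    curvature D a b (f • c) x = f x • curvature D a b c x +
      (anchorDeriv ρ a (anchorDeriv ρ b f) x - anchorDeriv ρ b (anchorDeriv ρ a f) x -
        anchorDeriv ρ (prodBracket D a b) f x) • c x := by
  have h : ∀ a b : Sec E F A, anchorDeriv ρ a (derivFun hD.smooth_anchor b f) x =
    anchorDeriv ρ a (anchorDeriv ρ b f) x := fun _ _ => rfl
  simp only [curvature, hD.fun_smul_right_eq, hD.add_right, ContMDiffSection.coe_sub,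
    ContMDiffSection.coe_add, Pi.sub_apply, Pi.add_apply, fun_smul_apply, derivFun_apply, h]
  module

end IsRightAnchoredProduct

/-- If a pairing is preserved by two operators, then the commutator defects of the operators
and of the anchor correspond to each other. -/
theorem anchorDeriv_commutator_pairing (P : ∀ x, A₁ x →ₗ[ℝ] A₂ x →ₗ[ℝ] ℝ)
    (hP : ∀ (s : Sec E F₁ A₁) (t : Sec E F₂ A₂),
      ContMDiff 𝓘(ℝ, E) 𝓘(ℝ, ℝ) ∞ (fun x => P x (s x) (t x)))
    (D₁ : Sec E F A → Sec E F₁ A₁ → Sec E F₁ A₁) (D₂ : Sec E F A → Sec E F₂ A₂ → Sec E F₂ A₂)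
    (h : ∀ a s t x, anchorDeriv ρ a (fun y => P y (s y) (t y)) x =
      P x (D₁ a s x) (t x) + P x (s x) (D₂ a t x))
    (a b c : Sec E F A) (s : Sec E F₁ A₁) (t : Sec E F₂ A₂) (x : M) :
    anchorDeriv ρ a (anchorDeriv ρ b fun y => P y (s y) (t y)) x -
        anchorDeriv ρ b (anchorDeriv ρ a fun y => P y (s y) (t y)) x -
        anchorDeriv ρ c (fun y => P y (s y) (t y)) x =
      P x ((D₁ a (D₁ b s) - D₁ b (D₁ a s) - D₁ c s) x) (t x) +
        P x (s x) ((D₂ a (D₂ b t) - D₂ b (D₂ a t) - D₂ c t) x) := by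
  have h' : ∀ a s t, anchorDeriv ρ a (fun y => P y (s y) (t y)) =
      fun x => P x (D₁ a s x) (t x) + P x (s x) (D₂ a t x) := fun a s t => funext (h a s t)
  simp only [h', anchorDeriv_add (hP _ _) (hP _ _), ContMDiffSection.coe_sub, Pi.sub_apply,
    map_sub, LinearMap.sub_apply]
  ring

end Products

/-! ### Metric connections satisfying the Bianchi identity -/

section Connections

variable {E : Type*} [NormedAddCommGroup E] [NormedSpace ℝ E] [FiniteDimensional ℝ E]
  {M : Type*} [TopologicalSpace M] [ChartedSpace E M] [IsManifold 𝓘(ℝ, E) ∞ M] [T2Space M]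
  {F : Type*} [NormedAddCommGroup F] [NormedSpace ℝ F] [FiniteDimensional ℝ F]
  {A : M → Type*} [∀ x, AddCommGroup (A x)] [∀ x, Module ℝ (A x)] [∀ x, TopologicalSpace (A x)]
  [TopologicalSpace (TotalSpace F A)] [FiberBundle F A] [VectorBundle ℝ F A]
  [ContMDiffVectorBundle ∞ F A 𝓘(ℝ, E)]
  {ρ : ∀ x, A x →ₗ[ℝ] TangentSpace 𝓘(ℝ, E) x} {g : ∀ x, A x →ₗ[ℝ] A x →ₗ[ℝ] ℝ}

/-- A right-anchored product preserving `g` whose curvature satisfies the first Bianchi identity.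
The Bianchi identity is the Jacobi identity of the bracket `[·,·]_D`, so that these are the
Levi-Civita connections of pseudo-Riemannian Lie algebroids, without mention of the bracket. -/
structure IsLeviCivitaProduct (ρ : ∀ x, A x →ₗ[ℝ] TangentSpace 𝓘(ℝ, E) x)
    (g : ∀ x, A x →ₗ[ℝ] A x →ₗ[ℝ] ℝ) (D : Sec E F A → Sec E F A → Sec E F A) : Prop
    extends IsRightAnchoredProduct ρ D where
  metric : ∀ a b c x, anchorDeriv ρ a (fun y => g y (b y) (c y)) x =
    g x (D a b x) (c x) + g x (b x) (D a c x)
  bianchi : ∀ a b c, curvature D a b c + curvature D b c a + curvature D c a b = 0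

theorem IsPseudoRiemannian.sec_ext (hg : IsPseudoRiemannian E F g) {s t : Sec E F A}
    (h : ∀ (c : Sec E F A) x, g x (s x) (c x) = g x (t x) (c x)) : s = t := by
  ext x
  refine (hg.bijective x).1 (LinearMap.ext fun v => ?_)
  obtain ⟨c, rfl⟩ := exists_sec_apply_eq (E := E) (F := F) x v
  exact h c x

namespace IsLieAlgebroid

variable {br : Sec E F A → Sec E F A → Sec E F A}

theorem add_left (hL : IsLieAlgebroid ρ br) (a b c : Sec E F A) :
    br (a + b) c = br a c + br b c := by
  rw [hL.skew, hL.add_right, hL.skew c a, hL.skew c b]; abel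

theorem anchored_left (hL : IsLieAlgebroid ρ br) (f : Fun E M) (a b : Sec E F A) (x : M) :
    br (f • a) b x = f x • br a b x - anchorDeriv ρ b f x • a x := by
  rw [hL.skew (f • a) b, hL.skew a b]
  simp only [ContMDiffSection.coe_neg, Pi.neg_apply, hL.anchored]
  module

theorem isRightAnchoredProduct_leviCivita (hL : IsLieAlgebroid ρ br)
    (hg : IsPseudoRiemannian E F g) : IsRightAnchoredProduct ρ (leviCivita hL hg) := by
  refine isRightAnchoredProduct_of_fun hL.smooth_anchor (fun a b c => hg.sec_ext fun d x => ?_)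
    (fun a b c => hg.sec_ext fun d x => ?_) (fun f a b => hg.sec_ext fun c x => ?_) ?_
  · simp only [ContMDiffSection.coe_add, Pi.add_apply, map_add, LinearMap.add_apply,
      leviCivita_spec, koszul, hL.add_left, hL.add_right, anchorDeriv_add_left,
      anchorDeriv_add (hg.contMDiff _ _) (hg.contMDiff _ _)]
    ring
  · simp only [ContMDiffSection.coe_add, Pi.add_apply, map_add, LinearMap.add_apply,
      leviCivita_spec, koszul, hL.add_right, anchorDeriv_add_left,
      anchorDeriv_add (hg.contMDiff _ _) (hg.contMDiff _ _)]
    ring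
  · simp only [fun_smul_apply, map_smul, LinearMap.smul_apply, smul_eq_mul, map_add, map_sub,
      LinearMap.add_apply, LinearMap.sub_apply,
      leviCivita_spec, koszul, hL.anchored, hL.anchored_left, anchorDeriv_fun_smul_left,
      anchorDeriv_mul f.contMDiff (hg.contMDiff _ _)]
    ring
  · intro f a b x
    have key : leviCivita hL hg a (f • b) =
        f • leviCivita hL hg a b + derivFun hL.smooth_anchor a f • b := by
      refine hg.sec_ext fun c x => ?_
      simp only [ContMDiffSection.coe_add, Pi.add_apply, fun_smul_apply, map_smul,
        LinearMap.smul_apply, smul_eq_mul, map_add, LinearMap.add_apply, derivFun_apply,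
        leviCivita_spec, koszul, hL.anchored, anchorDeriv_fun_smul_left,
        anchorDeriv_mul f.contMDiff (hg.contMDiff _ _), hg.symm x (a x) (b x)]
      ring
    exact DFunLike.congr_fun key x

theorem prodBracket_leviCivita (hL : IsLieAlgebroid ρ br) (hg : IsPseudoRiemannian E F g) :
    prodBracket (leviCivita hL hg) = br := by
  funext a b
  refine hg.sec_ext fun c x => ?_
  have h : ∀ u v : Sec E F A, (fun y => g y (u y) (v y)) = fun y => g y (v y) (u y) :=
    fun u v => funext fun y => hg.symm y _ _
  simp only [prodBracket, ContMDiffSection.coe_sub, Pi.sub_apply, map_sub, LinearMap.sub_apply,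
    leviCivita_spec, koszul]
  rw [h b a, hL.skew b a]
  simp only [ContMDiffSection.coe_neg, Pi.neg_apply, map_neg, LinearMap.neg_apply]
  ring

theorem isLeviCivitaProduct_leviCivita (hL : IsLieAlgebroid ρ br)
    (hg : IsPseudoRiemannian E F g) : IsLeviCivitaProduct ρ g (leviCivita hL hg) where
  toIsRightAnchoredProduct := hL.isRightAnchoredProduct_leviCivita hg
  metric a b c x := by
    have h : (fun y => g y (c y) (b y)) = fun y => g y (b y) (c y) :=
      funext fun y => hg.symm y _ _
    rw [hg.symm x (b x)]
    simp only [leviCivita_spec, koszul]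
    rw [h, hL.skew b a, hL.skew c b, hL.skew c a]
    simp only [ContMDiffSection.coe_neg, Pi.neg_apply, map_neg, LinearMap.neg_apply]
    ring
  bianchi a b c := by
    have hD := hL.isRightAnchoredProduct_leviCivita hg
    have h := hL.jacobi a b c
    rw [← hL.prodBracket_leviCivita hg] at h
    rw [← neg_eq_zero, ← h]
    simp only [curvature, prodBracket, hD.sub_left, hD.sub_right]
    abel

end IsLieAlgebroid

namespace IsLeviCivitaProduct

variable {D : Sec E F A → Sec E F A → Sec E F A}

theorem isLieAlgebroid (hD : IsLeviCivitaProduct ρ g D) : IsLieAlgebroid ρ (prodBracket D) where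
  smooth_anchor := hD.smooth_anchor
  skew a b := by simp [prodBracket]
  add_right a b c := by
    simp only [prodBracket, hD.add_left, hD.add_right]; abel
  smul_right r a b := by
    simp only [prodBracket, hD.smul_left, hD.smul_right, smul_sub]
  anchored f a b x := by
    simp only [prodBracket, hD.fun_smul_right_eq, hD.fun_smul_left, ContMDiffSection.coe_sub,
      ContMDiffSection.coe_add, Pi.sub_apply, Pi.add_apply, fun_smul_apply, derivFun_apply]
    module
  jacobi a b c := by
    rw [← neg_eq_zero, ← hD.bianchi a b c]
    have hD := hD.toIsRightAnchoredProduct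
    simp only [curvature, prodBracket, hD.sub_left, hD.sub_right]
    abel

/-- Uniqueness of the Levi-Civita connection. -/
theorem leviCivita_eq (hD : IsLeviCivitaProduct ρ g D) (hg : IsPseudoRiemannian E F g)
    (hL : IsLieAlgebroid ρ (prodBracket D)) : leviCivita hL hg = D := by
  funext a b
  refine hg.sec_ext fun c x => ?_
  simp only [leviCivita_spec, koszul, hD.metric, prodBracket, ContMDiffSection.coe_sub,
    Pi.sub_apply, map_sub, LinearMap.sub_apply]
  rw [hg.symm x (D c b x) (a x), hg.symm x (D b c x) (a x), hg.symm x (D a c x) (b x)]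
  ring

theorem isParaKahler (hD : IsLeviCivitaProduct ρ g D) (hg : IsPseudoRiemannian E F g)
    {K : ∀ x, A x →ₗ[ℝ] A x} (hK : IsSmoothHom E F F K) (hsq : ∀ x u, K x (K x u) = u)
    (hskew : ∀ x u v, g x (K x u) v = -g x u (K x v))
    (hpar : ∀ a b, D a (mapSec hK b) = mapSec hK (D a b)) :
    IsParaKahler ρ (prodBracket D) g K where
  lie := hD.isLieAlgebroid
  metric := hg
  smooth := hK
  sq := hsq
  skew := hskew
  parallel a b := by rw [hD.leviCivita_eq]; exact hpar a b

/-- The Bianchi identity makes the anchor a morphism of brackets wherever the fibre is not zero. -/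
theorem anchor_commutator_smul (hD : IsLeviCivitaProduct ρ g D) (a b c : Sec E F A) (f : Fun E M)
    (x : M) : (anchorDeriv ρ a (anchorDeriv ρ b f) x - anchorDeriv ρ b (anchorDeriv ρ a f) x -
        anchorDeriv ρ (prodBracket D a b) f x) • c x = 0 := by
  have h1 := DFunLike.congr_fun (hD.bianchi a b (f • c)) x
  have h2 := DFunLike.congr_fun (hD.bianchi a b c) x
  simp only [ContMDiffSection.coe_add, Pi.add_apply, ContMDiffSection.coe_zero, Pi.zero_apply,
    hD.curvature_fun_smul_left, hD.curvature_fun_smul_middle, hD.curvature_fun_smul_right,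
    fun_smul_apply] at h1 h2
  linear_combination (norm := module) h1 - f x • h2

theorem curvature_skew (hD : IsLeviCivitaProduct ρ g D) (hg : IsPseudoRiemannian E F g)
    (a b c d : Sec E F A) (x : M) :
    g x (curvature D a b c x) (d x) + g x (c x) (curvature D a b d x) = 0 := by
  have h1 := anchorDeriv_commutator_pairing g hg.contMDiff D D hD.metric a b (prodBracket D a b)
    c d x
  have h2 := hD.anchor_commutator_smul a b d ⟨_, hg.contMDiff c d⟩ x
  rcases smul_eq_zero.1 h2 with h2 | h2
  · exact h1.symm.trans h2
  -- the anchor need not be a morphism of brackets where `d` vanishes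
  · have h3 := hD.anchor_commutator_smul a b (curvature D a b d) ⟨_, hg.contMDiff c d⟩ x
    rcases smul_eq_zero.1 h3 with h3 | h3
    · exact h1.symm.trans h3
    · rw [h2, h3, map_zero, map_zero, add_zero]

/-- The pair symmetry `⟨R(a, b) c, d⟩ = ⟨R(c, d) a, b⟩`. -/
theorem curvature_pair_symm (hD : IsLeviCivitaProduct ρ g D) (hg : IsPseudoRiemannian E F g)
    (a b c d : Sec E F A) (x : M) :
    g x (curvature D a b c x) (d x) = g x (curvature D c d a x) (b x) := by
  have hB : ∀ a b c d : Sec E F A, g x (curvature D a b c x) (d x) +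
      g x (curvature D b c a x) (d x) + g x (curvature D c a b x) (d x) = 0 := by
    intro a b c d
    have h := DFunLike.congr_fun (hD.bianchi a b c) x
    have h' := congrArg (fun v => g x v (d x)) h
    simpa using h'
  have hS : ∀ a b c d : Sec E F A, g x (curvature D a b c x) (d x) =
      -g x (curvature D b a c x) (d x) := by
    intro a b c d
    rw [hD.curvature_swap a b c]
    simp
  have hT : ∀ a b c d : Sec E F A, g x (curvature D a b c x) (d x) =
      -g x (curvature D a b d x) (c x) := by
    intro a b c d
    have h := hD.curvature_skew hg a b c d x
    rw [hg.symm x (c x)] at h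
    linarith
  -- the sum of the four Bianchi identities, up to the two skew-symmetries
  have e1 := hB a b c d
  have e2 := hB b c d a
  have e3 := hB c d a b
  have e4 := hB d a b c
  linarith [hT b c d a, hT c d b a, hS d b c a, hT d a c b, hS a c d b, hS d a b c, hT a b d c,
    hT b d a c, hT c a d b, hT a d b c, hS c d a b, hS a d c b, hT d b a c, hS b d c a,
    hS b d a c, hT b d c a, hT c d a b, hS d a c b]

end IsLeviCivitaProduct

end Connections

/-! ### The phase space of two right-anchored products -/

section PhaseSpace

variable {E : Type*} [NormedAddCommGroup E] [NormedSpace ℝ E] [FiniteDimensional ℝ E]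
  {M : Type*} [TopologicalSpace M] [ChartedSpace E M] [IsManifold 𝓘(ℝ, E) ∞ M] [T2Space M]
  {F : Type*} [NormedAddCommGroup F] [NormedSpace ℝ F] [FiniteDimensional ℝ F]
  {B : M → Type*} [∀ x, AddCommGroup (B x)] [∀ x, Module ℝ (B x)] [∀ x, TopologicalSpace (B x)]
  [TopologicalSpace (TotalSpace F B)] [FiberBundle F B] [VectorBundle ℝ F B]
  [ContMDiffVectorBundle ∞ F B 𝓘(ℝ, E)]
  {ρ₀ : ∀ x, B x →ₗ[ℝ] TangentSpace 𝓘(ℝ, E) x} {S : Sec E F B → Sec E F B → Sec E F B}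
  {ρ₁ : ∀ x, Dual B x →ₗ[ℝ] TangentSpace 𝓘(ℝ, E) x}
  {T : Sec E (F →L[ℝ] ℝ) (Dual B) → Sec E (F →L[ℝ] ℝ) (Dual B) → Sec E (F →L[ℝ] ℝ) (Dual B)}

theorem dualSec_ext {α β : Sec E (F →L[ℝ] ℝ) (Dual B)}
    (h : ∀ (s : Sec E F B) x, α x (s x) = β x (s x)) : α = β := by
  ext x v
  obtain ⟨s, rfl⟩ := exists_sec_apply_eq (E := E) (F := F) x v
  exact h s x

theorem sec_ext_of_dual {X Y : Sec E F B}
    (h : ∀ (α : Sec E (F →L[ℝ] ℝ) (Dual B)) x, α x (X x) = α x (Y x)) : X = Y := by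
  ext x
  refine (evalDual_flip_bijective F x).1 (LinearMap.ext fun v => ?_)
  obtain ⟨s, rfl⟩ := exists_sec_apply_eq (E := E) (F := F →L[ℝ] ℝ) (A := Dual B) x v
  exact h s x

section DualProduct

variable (hS : IsRightAnchoredProduct ρ₀ S) (hT : IsRightAnchoredProduct ρ₁ T)

theorem dualProduct_add_left (X Y : Sec E F B) (α : Sec E (F →L[ℝ] ℝ) (Dual B)) :
    dualProduct hS (X + Y) α = dualProduct hS X α + dualProduct hS Y α := by
  refine dualSec_ext fun s x => ?_
  simp only [ContMDiffSection.coe_add, Pi.add_apply, add_apply, dualProduct_spec,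
    anchorDeriv_add_left, hS.add_left, map_add]
  ring

theorem dualProduct_add_right (X : Sec E F B) (α β : Sec E (F →L[ℝ] ℝ) (Dual B)) :
    dualProduct hS X (α + β) = dualProduct hS X α + dualProduct hS X β := by
  refine dualSec_ext fun s x => ?_
  simp only [ContMDiffSection.coe_add, Pi.add_apply, add_apply, dualProduct_spec,
    anchorDeriv_add (contMDiff_dual_apply α s) (contMDiff_dual_apply β s)]
  ring

theorem dualProduct_fun_smul_left (f : Fun E M) (X : Sec E F B)
    (α : Sec E (F →L[ℝ] ℝ) (Dual B)) :
    dualProduct hS (f • X) α = f • dualProduct hS X α := by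
  refine dualSec_ext fun s x => ?_
  simp only [fun_smul_apply, smul_apply, smul_eq_mul, dualProduct_spec,
    anchorDeriv_fun_smul_left, hS.fun_smul_left, map_smul]
  ring

theorem dualProduct_fun_smul_right (f : Fun E M) (X : Sec E F B)
    (α : Sec E (F →L[ℝ] ℝ) (Dual B)) :
    dualProduct hS X (f • α) = f • dualProduct hS X α + derivFun hS.smooth_anchor X f • α := by
  refine dualSec_ext fun s x => ?_
  simp only [fun_smul_apply, ContMDiffSection.coe_add, Pi.add_apply, add_apply, smul_apply,
    smul_eq_mul, dualProduct_spec, derivFun_apply,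
    anchorDeriv_mul f.contMDiff (contMDiff_dual_apply α s)]
  ring

theorem bidualProduct_add_left (α β : Sec E (F →L[ℝ] ℝ) (Dual B)) (X : Sec E F B) :
    bidualProduct hT (α + β) X = bidualProduct hT α X + bidualProduct hT β X := by
  refine sec_ext_of_dual fun γ x => ?_
  simp only [ContMDiffSection.coe_add, Pi.add_apply, add_apply, bidualProduct_spec,
    anchorDeriv_add_left, hT.add_left, map_add]
  ring

theorem bidualProduct_add_right (α : Sec E (F →L[ℝ] ℝ) (Dual B)) (X Y : Sec E F B) :
    bidualProduct hT α (X + Y) = bidualProduct hT α X + bidualProduct hT α Y := by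
  refine sec_ext_of_dual fun γ x => ?_
  simp only [ContMDiffSection.coe_add, Pi.add_apply, bidualProduct_spec, map_add,
    anchorDeriv_add (contMDiff_dual_apply γ X) (contMDiff_dual_apply γ Y)]
  ring

theorem bidualProduct_fun_smul_left (f : Fun E M) (α : Sec E (F →L[ℝ] ℝ) (Dual B))
    (X : Sec E F B) : bidualProduct hT (f • α) X = f • bidualProduct hT α X := by
  refine sec_ext_of_dual fun γ x => ?_
  simp only [fun_smul_apply, smul_apply, smul_eq_mul, bidualProduct_spec,
    anchorDeriv_fun_smul_left, hT.fun_smul_left, map_smul]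
  ring

theorem bidualProduct_fun_smul_right (f : Fun E M) (α : Sec E (F →L[ℝ] ℝ) (Dual B))
    (X : Sec E F B) : bidualProduct hT α (f • X) =
      f • bidualProduct hT α X + derivFun hT.smooth_anchor α f • X := by
  refine sec_ext_of_dual fun γ x => ?_
  simp only [fun_smul_apply, ContMDiffSection.coe_add, Pi.add_apply, map_add, map_smul,
    smul_eq_mul, bidualProduct_spec, derivFun_apply,
    anchorDeriv_mul f.contMDiff (contMDiff_dual_apply γ X)]
  ring

theorem dualProduct_zero_left (α : Sec E (F →L[ℝ] ℝ) (Dual B)) : dualProduct hS 0 α = 0 := by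
  have h := dualProduct_add_left hS 0 0 α
  rwa [add_zero, left_eq_add] at h

theorem dualProduct_zero_right (X : Sec E F B) : dualProduct hS X 0 = 0 := by
  have h := dualProduct_add_right hS X 0 0
  rwa [add_zero, left_eq_add] at h

theorem bidualProduct_zero_left (X : Sec E F B) : bidualProduct hT 0 X = 0 := by
  have h := bidualProduct_add_left hT 0 0 X
  rwa [add_zero, left_eq_add] at h

theorem bidualProduct_zero_right (α : Sec E (F →L[ℝ] ℝ) (Dual B)) : bidualProduct hT α 0 = 0 := by
  have h := bidualProduct_add_right hT α 0 0
  rwa [add_zero, left_eq_add] at h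

end DualProduct

section Pair

@[simp] theorem fstSec_pair (X : Sec E F B) (α : Sec E (F →L[ℝ] ℝ) (Dual B)) :
    fstSec (pair X α) = X := rfl

@[simp] theorem sndSec_pair (X : Sec E F B) (α : Sec E (F →L[ℝ] ℝ) (Dual B)) :
    sndSec (pair X α) = α := rfl

@[simp] theorem pair_fstSec_sndSec (u : Sec E (F × (F →L[ℝ] ℝ)) (Phase B)) :
    pair (fstSec u) (sndSec u) = u := rfl

@[simp] theorem fstSec_add (u v : Sec E (F × (F →L[ℝ] ℝ)) (Phase B)) :
    fstSec (u + v) = fstSec u + fstSec v := rfl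

@[simp] theorem sndSec_add (u v : Sec E (F × (F →L[ℝ] ℝ)) (Phase B)) :
    sndSec (u + v) = sndSec u + sndSec v := rfl

@[simp] theorem fstSec_sub (u v : Sec E (F × (F →L[ℝ] ℝ)) (Phase B)) :
    fstSec (u - v) = fstSec u - fstSec v := rfl

@[simp] theorem sndSec_sub (u v : Sec E (F × (F →L[ℝ] ℝ)) (Phase B)) :
    sndSec (u - v) = sndSec u - sndSec v := rfl

@[simp] theorem fstSec_fun_smul (f : Fun E M) (u : Sec E (F × (F →L[ℝ] ℝ)) (Phase B)) :
    fstSec (f • u) = f • fstSec u := rfl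

@[simp] theorem sndSec_fun_smul (f : Fun E M) (u : Sec E (F × (F →L[ℝ] ℝ)) (Phase B)) :
    sndSec (f • u) = f • sndSec u := rfl

theorem pair_add (X Y : Sec E F B) (α β : Sec E (F →L[ℝ] ℝ) (Dual B)) :
    pair (X + Y) (α + β) = pair X α + pair Y β := rfl

theorem pair_sub (X Y : Sec E F B) (α β : Sec E (F →L[ℝ] ℝ) (Dual B)) :
    pair (X - Y) (α - β) = pair X α - pair Y β := rfl

theorem pair_fun_smul (f : Fun E M) (X : Sec E F B) (α : Sec E (F →L[ℝ] ℝ) (Dual B)) :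
    pair (f • X) (f • α) = f • pair X α := rfl

theorem eq_pair_add_pair (u : Sec E (F × (F →L[ℝ] ℝ)) (Phase B)) :
    u = pair (fstSec u) 0 + pair 0 (sndSec u) := by
  rw [← pair_add, add_zero, zero_add, pair_fstSec_sndSec]

@[simp] theorem phaseMetric_apply (x : M) (v w : Phase B x) :
    phaseMetric x v w = v.2 w.1 + w.2 v.1 := rfl

@[simp] theorem phaseK_apply (x : M) (v : Phase B x) : phaseK x v = (v.1, -v.2) := rfl

@[simp] theorem phaseAnchor_apply (x : M) (v : Phase B x) :
    phaseAnchor ρ₀ ρ₁ x v = ρ₀ x v.1 + ρ₁ x v.2 := rfl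

theorem anchorDeriv_phaseAnchor (u : Sec E (F × (F →L[ℝ] ℝ)) (Phase B)) (f : M → ℝ) (x : M) :
    anchorDeriv (phaseAnchor ρ₀ ρ₁) u f x =
      anchorDeriv ρ₀ (fstSec u) f x + anchorDeriv ρ₁ (sndSec u) f x := by
  simp [anchorDeriv]

theorem isSmoothHom_phaseK : IsSmoothHom E (F × (F →L[ℝ] ℝ)) (F × (F →L[ℝ] ℝ))
    (phaseK (B := B)) :=
  isSmoothHom_of_sec _ fun u => (pair (fstSec u) (-sndSec u)).contMDiff

theorem mapSec_phaseK (u : Sec E (F × (F →L[ℝ] ℝ)) (Phase B)) :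
    mapSec isSmoothHom_phaseK u = pair (fstSec u) (-sndSec u) := rfl

theorem isSmoothHom_phaseAnchor (h₀ : IsSmoothHom E F E ρ₀)
    (h₁ : IsSmoothHom E (F →L[ℝ] ℝ) E ρ₁) :
    IsSmoothHom E (F × (F →L[ℝ] ℝ)) E (phaseAnchor ρ₀ ρ₁) :=
  isSmoothHom_of_sec _ fun u => (mapSec h₀ (fstSec u) + mapSec h₁ (sndSec u)).contMDiff

theorem isPseudoRiemannian_phaseMetric :
    IsPseudoRiemannian E (F × (F →L[ℝ] ℝ)) (phaseMetric (B := B)) where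
  symm x u v := add_comm _ _
  nondegenerate x u h := by
    have h1 : ∀ v : B x, u.2 v = 0 := fun v => by simpa using h (v, 0)
    have h2 : ∀ α : Dual B x, α u.1 = 0 := fun α => by simpa using h (0, α)
    refine Prod.ext ((evalDual_flip_bijective F x).1 (LinearMap.ext fun α => ?_))
      (ContinuousLinearMap.ext h1)
    exact (h2 α).trans (map_zero α).symm
  smooth U a b hU ha hb := by
    have hfst : ∀ a : ∀ x, Phase B x,
        ContMDiffOn 𝓘(ℝ, E) (𝓘(ℝ, E).prod 𝓘(ℝ, F × (F →L[ℝ] ℝ))) ∞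
          (fun x => (⟨x, a x⟩ : TotalSpace (F × (F →L[ℝ] ℝ)) (Phase B))) U →
        ContMDiffOn 𝓘(ℝ, E) (𝓘(ℝ, E).prod 𝓘(ℝ, F)) ∞
          (fun x => (⟨x, (a x).1⟩ : TotalSpace F B)) U := fun a ha x hx =>
      contMDiffWithinAt_section.2 <|
        ((ContinuousLinearMap.fst ℝ F (F →L[ℝ] ℝ)).contMDiff.contMDiffAt
          (x := _)).comp_contMDiffWithinAt x (contMDiffWithinAt_section.1 (ha x hx))
    have hsnd : ∀ a : ∀ x, Phase B x,
        ContMDiffOn 𝓘(ℝ, E) (𝓘(ℝ, E).prod 𝓘(ℝ, F × (F →L[ℝ] ℝ))) ∞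
          (fun x => (⟨x, a x⟩ : TotalSpace (F × (F →L[ℝ] ℝ)) (Phase B))) U →
        ContMDiffOn 𝓘(ℝ, E) (𝓘(ℝ, E).prod 𝓘(ℝ, F →L[ℝ] ℝ)) ∞
          (fun x => (⟨x, (a x).2⟩ : TotalSpace (F →L[ℝ] ℝ) (Dual B))) U := fun a ha x hx =>
      contMDiffWithinAt_section.2 <|
        ((ContinuousLinearMap.snd ℝ F (F →L[ℝ] ℝ)).contMDiff.contMDiffAt
          (x := _)).comp_contMDiffWithinAt x (contMDiffWithinAt_section.1 (ha x hx))
    have happ : ∀ a b : ∀ x, Phase B x,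
        ContMDiffOn 𝓘(ℝ, E) (𝓘(ℝ, E).prod 𝓘(ℝ, F × (F →L[ℝ] ℝ))) ∞
          (fun x => (⟨x, a x⟩ : TotalSpace (F × (F →L[ℝ] ℝ)) (Phase B))) U →
        ContMDiffOn 𝓘(ℝ, E) (𝓘(ℝ, E).prod 𝓘(ℝ, F × (F →L[ℝ] ℝ))) ∞
          (fun x => (⟨x, b x⟩ : TotalSpace (F × (F →L[ℝ] ℝ)) (Phase B))) U →
        ContMDiffOn 𝓘(ℝ, E) 𝓘(ℝ, ℝ) ∞ (fun x => (a x).2 (b x).1) U := by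
      intro a b ha hb
      have h := ContMDiffOn.clm_bundle_apply (E₂ := Bundle.Trivial M ℝ) (hsnd a ha) (hfst b hb)
      exact fun x hx => contMDiffWithinAt_section.1 (h x hx)
    exact (happ a b ha hb).add (happ b a hb ha)

end Pair

section Product

variable (hS : IsRightAnchoredProduct ρ₀ S) (hT : IsRightAnchoredProduct ρ₁ T)

theorem phaseProduct_pair (X Y : Sec E F B) (α β : Sec E (F →L[ℝ] ℝ) (Dual B)) :
    phaseProduct hS hT (pair X α) (pair Y β) =
      pair (S X Y + bidualProduct hT α Y) (dualProduct hS X β + T α β) := rfl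

theorem prodBracket_phaseProduct :
    prodBracket (phaseProduct hS hT) = phaseBracket hS hT := by
  funext u v
  simp only [prodBracket, phaseProduct, phaseBracket, ← pair_sub]
  congr 1 <;> abel

theorem isRightAnchoredProduct_phaseProduct :
    IsRightAnchoredProduct (phaseAnchor ρ₀ ρ₁) (phaseProduct hS hT) := by
  refine isRightAnchoredProduct_of_fun
    (isSmoothHom_phaseAnchor hS.smooth_anchor hT.smooth_anchor) (fun u v w => ?_)
    (fun u v w => ?_) (fun f u v => ?_) ?_
  · simp only [phaseProduct, fstSec_add, sndSec_add, hS.add_left, hT.add_left,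
      dualProduct_add_left, bidualProduct_add_left, ← pair_add]
    congr 1 <;> abel
  · simp only [phaseProduct, fstSec_add, sndSec_add, hS.add_right, hT.add_right,
      dualProduct_add_right, bidualProduct_add_right, ← pair_add]
    congr 1 <;> abel
  · simp only [phaseProduct, fstSec_fun_smul, sndSec_fun_smul, hS.fun_smul_left, hT.fun_smul_left,
      dualProduct_fun_smul_left, bidualProduct_fun_smul_left, ← pair_fun_smul]
    congr 1 <;> (ext x; simp [smul_add])
  · intro f u v x
    simp only [phaseProduct, fstSec_fun_smul, sndSec_fun_smul, hS.fun_smul_right_eq,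
      hT.fun_smul_right_eq, dualProduct_fun_smul_right, bidualProduct_fun_smul_right,
      pair_apply, ContMDiffSection.coe_add, Pi.add_apply, fun_smul_apply, derivFun_apply,
      anchorDeriv_phaseAnchor]
    refine Prod.ext ?_ ?_
    · simp only [Prod.fst_add, Prod.smul_fst, fstSec_apply]
      module
    · simp only [Prod.snd_add, Prod.smul_snd, sndSec_apply]
      module

theorem phaseProduct_metric (u v w : Sec E (F × (F →L[ℝ] ℝ)) (Phase B)) (x : M) :
    anchorDeriv (phaseAnchor ρ₀ ρ₁) u (fun y => phaseMetric y (v y) (w y)) x =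
      phaseMetric x (phaseProduct hS hT u v x) (w x) +
        phaseMetric x (v x) (phaseProduct hS hT u w x) := by
  have h1 : ∀ v w : Sec E (F × (F →L[ℝ] ℝ)) (Phase B), ContMDiff 𝓘(ℝ, E) 𝓘(ℝ, ℝ) ∞
    (fun y => (v y).2 (w y).1) := fun v w => contMDiff_dual_apply (sndSec v) (fstSec w)
  have h2 : ∀ v w : Sec E (F × (F →L[ℝ] ℝ)) (Phase B),
      anchorDeriv ρ₀ (fstSec u) (fun y => (v y).2 (w y).1) x =
        dualProduct hS (fstSec u) (sndSec v) x (w x).1 + (v x).2 (S (fstSec u) (fstSec w) x) := by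
    intro v w
    have h := dualProduct_spec hS (fstSec u) (sndSec v) (fstSec w) x
    simp only [fstSec_apply, sndSec_apply] at h
    linarith
  have h3 : ∀ v w : Sec E (F × (F →L[ℝ] ℝ)) (Phase B),
      anchorDeriv ρ₁ (sndSec u) (fun y => (v y).2 (w y).1) x =
        (v x).2 (bidualProduct hT (sndSec u) (fstSec w) x) +
          T (sndSec u) (sndSec v) x (w x).1 := by
    intro v w
    have h := bidualProduct_spec hT (sndSec u) (fstSec w) (sndSec v) x
    simp only [fstSec_apply, sndSec_apply] at h
    linarith
  simp only [phaseMetric_apply, anchorDeriv_add (h1 _ _) (h1 _ _), anchorDeriv_phaseAnchor, h2, h3,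
    phaseProduct, pair_apply, ContMDiffSection.coe_add, Pi.add_apply, map_add, add_apply]
  ring

theorem phaseProduct_phaseK (u v : Sec E (F × (F →L[ℝ] ℝ)) (Phase B)) :
    phaseProduct hS hT u (mapSec isSmoothHom_phaseK v) =
      mapSec isSmoothHom_phaseK (phaseProduct hS hT u v) := by
  have h : ∀ X (α : Sec E (F →L[ℝ] ℝ) (Dual B)), dualProduct hS X (-α) = -dualProduct hS X α :=
    fun X α => eq_neg_of_add_eq_zero_left
      (by rw [← dualProduct_add_right, neg_add_cancel, dualProduct_zero_right])
  rw [mapSec_phaseK, mapSec_phaseK]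
  simp only [phaseProduct, fstSec_pair, sndSec_pair, h, hT.neg_right, neg_add]

theorem sndSec_curvature_fst (u v : Sec E (F × (F →L[ℝ] ℝ)) (Phase B)) (Z : Sec E F B) :
    sndSec (curvature (phaseProduct hS hT) u v (pair Z 0)) = 0 := by
  simp only [curvature, sndSec_sub, phaseProduct, sndSec_pair, dualProduct_zero_right,
    hT.zero_right, add_zero, sub_zero]

theorem fstSec_curvature_snd (u v : Sec E (F × (F →L[ℝ] ℝ)) (Phase B))
    (γ : Sec E (F →L[ℝ] ℝ) (Dual B)) :
    fstSec (curvature (phaseProduct hS hT) u v (pair 0 γ)) = 0 := by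
  simp only [curvature, fstSec_sub, phaseProduct, fstSec_pair, bidualProduct_zero_right,
    hS.zero_right, add_zero, sub_zero]

theorem prodBracket_phaseProduct_fst (X Y : Sec E F B) :
    prodBracket (phaseProduct hS hT) (pair X 0) (pair Y 0) = pair (prodBracket S X Y) 0 := by
  simp only [prodBracket, phaseProduct_pair, bidualProduct_zero_left, dualProduct_zero_right,
    hT.zero_right, add_zero, ← pair_sub, sub_zero]

theorem prodBracket_phaseProduct_snd (α β : Sec E (F →L[ℝ] ℝ) (Dual B)) :
    prodBracket (phaseProduct hS hT) (pair 0 α) (pair 0 β) = pair 0 (prodBracket T α β) := by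
  simp only [prodBracket, phaseProduct_pair, bidualProduct_zero_right, dualProduct_zero_left,
    hS.zero_right, zero_add, add_zero, ← pair_sub, sub_zero]

theorem fstSec_curvature_fst (X Y Z : Sec E F B) :
    fstSec (curvature (phaseProduct hS hT) (pair X 0) (pair Y 0) (pair Z 0)) =
      curvature S X Y Z := by
  rw [curvature, prodBracket_phaseProduct_fst]
  simp only [curvature, phaseProduct, fstSec_sub, sndSec_pair, fstSec_pair,
    bidualProduct_zero_left, add_zero]

theorem sndSec_curvature_snd (α β γ : Sec E (F →L[ℝ] ℝ) (Dual B)) :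
    sndSec (curvature (phaseProduct hS hT) (pair 0 α) (pair 0 β) (pair 0 γ)) =
      curvature T α β γ := by
  rw [curvature, prodBracket_phaseProduct_snd]
  simp only [curvature, phaseProduct, sndSec_sub, sndSec_pair, fstSec_pair,
    dualProduct_zero_left, zero_add]

end Product

end PhaseSpace

/-! ### Lie-extendibility and the Bianchi identity -/

section Extendible

variable {E : Type*} [NormedAddCommGroup E] [NormedSpace ℝ E] [FiniteDimensional ℝ E]
  {M : Type*} [TopologicalSpace M] [ChartedSpace E M] [IsManifold 𝓘(ℝ, E) ∞ M] [T2Space M]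
  {F : Type*} [NormedAddCommGroup F] [NormedSpace ℝ F] [FiniteDimensional ℝ F]
  {B : M → Type*} [∀ x, AddCommGroup (B x)] [∀ x, Module ℝ (B x)] [∀ x, TopologicalSpace (B x)]
  [TopologicalSpace (TotalSpace F B)] [FiberBundle F B] [VectorBundle ℝ F B]
  [ContMDiffVectorBundle ∞ F B 𝓘(ℝ, E)]
  {ρ₀ : ∀ x, B x →ₗ[ℝ] TangentSpace 𝓘(ℝ, E) x} {S : Sec E F B → Sec E F B → Sec E F B}
  {ρ₁ : ∀ x, Dual B x →ₗ[ℝ] TangentSpace 𝓘(ℝ, E) x}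
  {T : Sec E (F →L[ℝ] ℝ) (Dual B) → Sec E (F →L[ℝ] ℝ) (Dual B) → Sec E (F →L[ℝ] ℝ) (Dual B)}

theorem sec_eq_zero_of_eq_neg {X : Sec E F B} (h : X = -X) : X = 0 := by
  have h2 : (2 : ℝ) • X = 0 := by
    rw [two_smul]
    nth_rewrite 2 [h]
    exact add_neg_cancel X
  exact (smul_eq_zero.1 h2).resolve_left two_ne_zero

/-- Flatness makes the anchor a morphism of brackets wherever the fibre is not zero. -/
theorem IsLeftSymmetricAlgebroid.anchor_commutator_smul (hS : IsLeftSymmetricAlgebroid ρ₀ S)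
    (a b c : Sec E F B) (f : Fun E M) (x : M) :
    (anchorDeriv ρ₀ a (anchorDeriv ρ₀ b f) x - anchorDeriv ρ₀ b (anchorDeriv ρ₀ a f) x -
        anchorDeriv ρ₀ (prodBracket S a b) f x) • c x = 0 := by
  have h := hS.curvature_fun_smul_right f a b c x
  rw [hS.flat, hS.flat] at h
  simpa using h.symm

/-- The dual `S*` of a flat product is flat. -/
theorem curvature_fst_fst_snd (hS : IsLeftSymmetricAlgebroid ρ₀ S)
    (hT : IsRightAnchoredProduct ρ₁ T) (X Y : Sec E F B) (γ : Sec E (F →L[ℝ] ℝ) (Dual B)) :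
    curvature (phaseProduct hS.toIsRightAnchoredProduct hT) (pair X 0) (pair Y 0) (pair 0 γ) =
      0 := by
  have hS' := hS.toIsRightAnchoredProduct
  have h0 : sndSec (curvature (phaseProduct hS' hT) (pair X 0) (pair Y 0) (pair 0 γ)) = 0 := by
    have h1 : sndSec (curvature (phaseProduct hS' hT) (pair X 0) (pair Y 0) (pair 0 γ)) =
        dualProduct hS' X (dualProduct hS' Y γ) - dualProduct hS' Y (dualProduct hS' X γ) -
          dualProduct hS' (prodBracket S X Y) γ := by
      rw [curvature, prodBracket_phaseProduct_fst]
      have hT0 : ∀ β, T 0 β = 0 := hT.zero_left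
      simp only [phaseProduct, sndSec_sub, sndSec_pair, fstSec_pair, hT0, add_zero]
    rw [h1]
    refine dualSec_ext fun Z x => ?_
    have h2 := anchorDeriv_commutator_pairing (ρ := ρ₀) evalDual contMDiff_dual_apply
      (dualProduct hS') S (fun a s t x => by
        show anchorDeriv ρ₀ a (fun y => s y (t y)) x = dualProduct hS' a s x (t x) + s x (S a t x)
        rw [dualProduct_spec]; ring) X Y (prodBracket S X Y) γ Z x
    have h3 : S X (S Y Z) - S Y (S X Z) - S (prodBracket S X Y) Z = 0 := hS.flat X Y Z
    rw [h3] at h2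
    -- the anchor may fail to be a morphism of brackets at `x` only if `Z x = 0`
    have h4 := hS.anchor_commutator_smul X Y Z ⟨_, contMDiff_dual_apply γ Z⟩ x
    rcases smul_eq_zero.1 h4 with h4 | h4
    · have h5 := h2.symm.trans h4
      rw [ContMDiffSection.coe_zero, Pi.zero_apply, map_zero, add_zero] at h5
      exact h5
    · rw [h4, map_zero, map_zero]
  rw [← pair_fstSec_sndSec (curvature _ _ _ _), h0, fstSec_curvature_snd]
  rfl

/-- The dual `T*` of a flat product is flat. -/
theorem curvature_snd_snd_fst (hS : IsRightAnchoredProduct ρ₀ S)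
    (hT : IsLeftSymmetricAlgebroid ρ₁ T) (α β : Sec E (F →L[ℝ] ℝ) (Dual B)) (Z : Sec E F B) :
    curvature (phaseProduct hS hT.toIsRightAnchoredProduct) (pair 0 α) (pair 0 β) (pair Z 0) =
      0 := by
  have hT' := hT.toIsRightAnchoredProduct
  have h0 : fstSec (curvature (phaseProduct hS hT') (pair 0 α) (pair 0 β) (pair Z 0)) = 0 := by
    have h1 : fstSec (curvature (phaseProduct hS hT') (pair 0 α) (pair 0 β) (pair Z 0)) =
        bidualProduct hT' α (bidualProduct hT' β Z) - bidualProduct hT' β (bidualProduct hT' α Z) -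
          bidualProduct hT' (prodBracket T α β) Z := by
      rw [curvature, prodBracket_phaseProduct_snd]
      have hS0 : ∀ Y, S 0 Y = 0 := hS.zero_left
      simp only [phaseProduct, fstSec_sub, sndSec_pair, fstSec_pair, hS0, zero_add]
    rw [h1]
    refine sec_ext_of_dual fun γ x => ?_
    have h2 := anchorDeriv_commutator_pairing (ρ := ρ₁) evalDual contMDiff_dual_apply
      T (bidualProduct hT') (fun a s t x => by
        show anchorDeriv ρ₁ a (fun y => s y (t y)) x = T a s x (t x) + s x (bidualProduct hT' a t x)
        rw [bidualProduct_spec]; ring) α β (prodBracket T α β) γ Z x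
    have h3 : T α (T β γ) - T β (T α γ) - T (prodBracket T α β) γ = 0 := hT.flat α β γ
    rw [h3] at h2
    -- the anchor may fail to be a morphism of brackets at `x` only if `γ x = 0`
    have h4 := hT.anchor_commutator_smul α β γ ⟨_, contMDiff_dual_apply γ Z⟩ x
    rcases smul_eq_zero.1 h4 with h4 | h4
    · have h5 := h2.symm.trans h4
      rw [ContMDiffSection.coe_zero, Pi.zero_apply, map_zero, LinearMap.zero_apply, zero_add] at h5
      rw [ContMDiffSection.coe_zero, Pi.zero_apply, map_zero]
      exact h5
    · rw [h4, zero_apply, zero_apply]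
  rw [← pair_fstSec_sndSec (curvature _ _ _ _), h0, sndSec_curvature_fst]
  rfl

theorem curvature_fst_fst_fst (hS : IsLeftSymmetricAlgebroid ρ₀ S)
    (hT : IsRightAnchoredProduct ρ₁ T) (X Y Z : Sec E F B) :
    curvature (phaseProduct hS.toIsRightAnchoredProduct hT) (pair X 0) (pair Y 0) (pair Z 0) =
      0 := by
  rw [← pair_fstSec_sndSec (curvature _ _ _ _), fstSec_curvature_fst, sndSec_curvature_fst,
    hS.flat]
  rfl

theorem curvature_snd_snd_snd (hS : IsRightAnchoredProduct ρ₀ S)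
    (hT : IsLeftSymmetricAlgebroid ρ₁ T) (α β γ : Sec E (F →L[ℝ] ℝ) (Dual B)) :
    curvature (phaseProduct hS hT.toIsRightAnchoredProduct) (pair 0 α) (pair 0 β) (pair 0 γ) =
      0 := by
  rw [← pair_fstSec_sndSec (curvature _ _ _ _), sndSec_curvature_snd, fstSec_curvature_snd,
    hT.flat]
  rfl

/-- Lie-extendibility of two left symmetric algebroids amounts to the Bianchi identity for the
phase product: the other components of the cyclic sum vanish by flatness of the two products and
of their duals. -/
theorem isLeviCivitaProduct_phaseProduct (hS : IsLeftSymmetricAlgebroid ρ₀ S)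
    (hT : IsLeftSymmetricAlgebroid ρ₁ T)
    (h : IsLieExtendible hS.toIsRightAnchoredProduct hT.toIsRightAnchoredProduct) :
    IsLeviCivitaProduct (phaseAnchor ρ₀ ρ₁) phaseMetric
      (phaseProduct hS.toIsRightAnchoredProduct hT.toIsRightAnchoredProduct) where
  toIsRightAnchoredProduct := isRightAnchoredProduct_phaseProduct _ _
  metric := phaseProduct_metric _ _
  bianchi u v w := by
    have hD := isRightAnchoredProduct_phaseProduct hS.toIsRightAnchoredProduct
      hT.toIsRightAnchoredProduct
    set R := curvature (phaseProduct hS.toIsRightAnchoredProduct hT.toIsRightAnchoredProduct)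
      with hR
    have h1 : ∀ (X Y : Sec E F B) (γ : Sec E (F →L[ℝ] ℝ) (Dual B)),
        R (pair Y 0) (pair 0 γ) (pair X 0) + R (pair 0 γ) (pair X 0) (pair Y 0) = 0 := by
      intro X Y γ
      rw [hR, hD.curvature_swap (pair 0 γ), h.left X Y γ, add_neg_cancel]
    have h2 : ∀ (α β : Sec E (F →L[ℝ] ℝ) (Dual B)) (Z : Sec E F B),
        R (pair 0 β) (pair Z 0) (pair 0 α) + R (pair Z 0) (pair 0 α) (pair 0 β) = 0 := by
      intro α β Z
      rw [hR, hD.curvature_swap (pair Z 0), h.right Z α β, add_neg_cancel]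
    have e1 : ∀ X Y Z, R (pair X 0) (pair Y 0) (pair Z 0) = 0 := curvature_fst_fst_fst hS _
    have e2 : ∀ X Y γ, R (pair X 0) (pair Y 0) (pair 0 γ) = 0 := curvature_fst_fst_snd hS _
    have e3 : ∀ α β Z, R (pair 0 α) (pair 0 β) (pair Z 0) = 0 := curvature_snd_snd_fst _ hT
    have e4 : ∀ α β γ, R (pair 0 α) (pair 0 β) (pair 0 γ) = 0 := curvature_snd_snd_snd _ hT
    have a1 : ∀ a b c d, R (a + b) c d = R a c d + R b c d := hD.curvature_add_left
    have a2 : ∀ a b c d, R a (b + c) d = R a b d + R a c d := hD.curvature_add_middle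
    have a3 : ∀ a b c d, R a b (c + d) = R a b c + R a b d := hD.curvature_add_right
    clear_value R
    rw [eq_pair_add_pair u, eq_pair_add_pair v, eq_pair_add_pair w]
    simp only [a1, a2, a3, e1, e2, e3, e4, zero_add, add_zero]
    have f1 := h1 (fstSec u) (fstSec v) (sndSec w)
    have f2 := h1 (fstSec v) (fstSec w) (sndSec u)
    have f3 := h1 (fstSec w) (fstSec u) (sndSec v)
    have f4 := h2 (sndSec u) (sndSec v) (fstSec w)
    have f5 := h2 (sndSec v) (sndSec w) (fstSec u)
    have f6 := h2 (sndSec w) (sndSec u) (fstSec v)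
    linear_combination (norm := module) f1 + f2 + f3 + f4 + f5 + f6

/-- The phase space of two Lie-extendible left symmetric algebroids is para-Kähler. -/
theorem isParaKahler_phase (hS : IsLeftSymmetricAlgebroid ρ₀ S)
    (hT : IsLeftSymmetricAlgebroid ρ₁ T)
    (h : IsLieExtendible hS.toIsRightAnchoredProduct hT.toIsRightAnchoredProduct) :
    IsParaKahler (phaseAnchor ρ₀ ρ₁)
      (phaseBracket hS.toIsRightAnchoredProduct hT.toIsRightAnchoredProduct)
      phaseMetric phaseK := by
  rw [← prodBracket_phaseProduct]
  refine (isLeviCivitaProduct_phaseProduct hS hT h).isParaKahler isPseudoRiemannian_phaseMetric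
    isSmoothHom_phaseK (fun x u => ?_) (fun x u v => ?_) (phaseProduct_phaseK _ _)
  · simp
  · simp only [phaseMetric_apply, phaseK_apply, neg_apply]
    ring

/-- A metric product on the phase space for which `K₀` is parallel is the phase product of its
restrictions to `B` and `B*`; if it satisfies the Bianchi identity, then these restrictions are
flat and Lie-extendible. -/
theorem IsLeviCivitaProduct.exists_eq_phaseProduct
    {ρ : ∀ x, Phase B x →ₗ[ℝ] TangentSpace 𝓘(ℝ, E) x}
    {D : Sec E (F × (F →L[ℝ] ℝ)) (Phase B) → Sec E (F × (F →L[ℝ] ℝ)) (Phase B) →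
      Sec E (F × (F →L[ℝ] ℝ)) (Phase B)}
    (hD : IsLeviCivitaProduct ρ phaseMetric D)
    (hK : ∀ u v, D u (mapSec isSmoothHom_phaseK v) = mapSec isSmoothHom_phaseK (D u v)) :
    ∃ (ρ₀ : ∀ x, B x →ₗ[ℝ] TangentSpace 𝓘(ℝ, E) x) (S : Sec E F B → Sec E F B → Sec E F B)
      (ρ₁ : ∀ x, Dual B x →ₗ[ℝ] TangentSpace 𝓘(ℝ, E) x)
      (T : Sec E (F →L[ℝ] ℝ) (Dual B) → Sec E (F →L[ℝ] ℝ) (Dual B) →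
        Sec E (F →L[ℝ] ℝ) (Dual B))
      (hS : IsLeftSymmetricAlgebroid ρ₀ S) (hT : IsLeftSymmetricAlgebroid ρ₁ T),
      IsLieExtendible hS.toIsRightAnchoredProduct hT.toIsRightAnchoredProduct ∧
      ρ = phaseAnchor ρ₀ ρ₁ ∧
      D = phaseProduct hS.toIsRightAnchoredProduct hT.toIsRightAnchoredProduct := by
  let ρ₀ : ∀ x, B x →ₗ[ℝ] TangentSpace 𝓘(ℝ, E) x := fun x => ρ x ∘ₗ LinearMap.inl ℝ _ _
  let ρ₁ : ∀ x, Dual B x →ₗ[ℝ] TangentSpace 𝓘(ℝ, E) x := fun x => ρ x ∘ₗ LinearMap.inr ℝ _ _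
  let S : Sec E F B → Sec E F B → Sec E F B := fun X Y => fstSec (D (pair X 0) (pair Y 0))
  let T : Sec E (F →L[ℝ] ℝ) (Dual B) → Sec E (F →L[ℝ] ℝ) (Dual B) → Sec E (F →L[ℝ] ℝ) (Dual B) :=
    fun α β => sndSec (D (pair 0 α) (pair 0 β))
  have hinl : ∀ X Y : Sec E F B, pair (X + Y) (0 : Sec E (F →L[ℝ] ℝ) (Dual B)) =
      pair X 0 + pair Y 0 := fun X Y => by rw [← pair_add, add_zero]
  have hinr : ∀ α β : Sec E (F →L[ℝ] ℝ) (Dual B), pair (0 : Sec E F B) (α + β) =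
      pair 0 α + pair 0 β := fun X Y => by rw [← pair_add, add_zero]
  have hinl' : ∀ (f : Fun E M) (X : Sec E F B),
      pair (f • X) (0 : Sec E (F →L[ℝ] ℝ) (Dual B)) = f • pair X 0 := fun f X => by
    exact ContMDiffSection.ext fun x => Prod.ext rfl (smul_zero (f x)).symm
  have hinr' : ∀ (f : Fun E M) (α : Sec E (F →L[ℝ] ℝ) (Dual B)),
      pair (0 : Sec E F B) (f • α) = f • pair 0 α := fun f X => by
    exact ContMDiffSection.ext fun x => Prod.ext (smul_zero (f x)).symm rfl
  -- `D_u` preserves the eigenbundles of `K₀`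
  have hfst : ∀ u (Y : Sec E F B), sndSec (D u (pair Y 0)) = 0 := by
    intro u Y
    have h := congrArg sndSec (hK u (pair Y 0))
    have h0 : mapSec isSmoothHom_phaseK (pair Y (0 : Sec E (F →L[ℝ] ℝ) (Dual B))) = pair Y 0 := by
      rw [mapSec_phaseK]; simp
    rw [h0, mapSec_phaseK, sndSec_pair] at h
    exact sec_eq_zero_of_eq_neg h
  have hsnd : ∀ u (β : Sec E (F →L[ℝ] ℝ) (Dual B)), fstSec (D u (pair 0 β)) = 0 := by
    intro u β
    have h := congrArg fstSec (hK u (pair 0 β))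
    have h0 : mapSec isSmoothHom_phaseK (pair (0 : Sec E F B) β) = -pair 0 β := by
      rw [mapSec_phaseK]
      exact ContMDiffSection.ext fun x => Prod.ext neg_zero.symm rfl
    rw [h0, hD.neg_right, mapSec_phaseK, fstSec_pair] at h
    exact sec_eq_zero_of_eq_neg h.symm
  have hS : IsRightAnchoredProduct ρ₀ S := by
    refine isRightAnchoredProduct_of_fun
      (isSmoothHom_of_sec _ fun X => (mapSec hD.smooth_anchor (pair X 0)).contMDiff)
      (fun X Y Z => ?_) (fun X Y Z => ?_) (fun f X Y => ?_) (fun f X Y x => ?_)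
    · simp only [S, hinl, hD.add_left, fstSec_add]
    · simp only [S, hinl, hD.add_right, fstSec_add]
    · simp only [S, hinl', hD.fun_smul_left, fstSec_fun_smul]
    · simp only [S, hinl', fstSec_apply, hD.fun_smul_right]
      rfl
  have hT : IsRightAnchoredProduct ρ₁ T := by
    refine isRightAnchoredProduct_of_fun
      (isSmoothHom_of_sec _ fun α => (mapSec hD.smooth_anchor (pair 0 α)).contMDiff)
      (fun X Y Z => ?_) (fun X Y Z => ?_) (fun f X Y => ?_) (fun f X Y x => ?_)
    · simp only [T, hinr, hD.add_left, sndSec_add]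
    · simp only [T, hinr, hD.add_right, sndSec_add]
    · simp only [T, hinr', hD.fun_smul_left, sndSec_fun_smul]
    · simp only [T, hinr', sndSec_apply, hD.fun_smul_right]
      rfl
  have hρ : ρ = phaseAnchor ρ₀ ρ₁ := funext fun x => (LinearMap.coprod_comp_inl_inr (ρ x)).symm
  have hDeq : D = phaseProduct hS hT := by
    have hdual : ∀ X β, dualProduct hS X β = sndSec (D (pair X 0) (pair 0 β)) := by
      intro X β
      refine dualSec_ext fun Z x => ?_
      have h1 := hD.metric (pair X 0) (pair 0 β) (pair Z 0) x
      simp only [phaseMetric_apply, pair_apply, ContMDiffSection.coe_zero, Pi.zero_apply,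
        zero_apply, map_zero, add_zero] at h1
      rw [dualProduct_spec, sub_eq_iff_eq_add]
      exact h1
    have hbidual : ∀ α Y, bidualProduct hT α Y = fstSec (D (pair 0 α) (pair Y 0)) := by
      intro α Y
      refine sec_ext_of_dual fun β x => ?_
      have h1 := hD.metric (pair 0 α) (pair 0 β) (pair Y 0) x
      simp only [phaseMetric_apply, pair_apply, ContMDiffSection.coe_zero, Pi.zero_apply,
        zero_apply, map_zero, add_zero] at h1
      rw [bidualProduct_spec, sub_eq_iff_eq_add']
      exact h1
    funext u v
    have h1 : D u v = D (pair (fstSec u) 0) (pair (fstSec v) 0) +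
        D (pair 0 (sndSec u)) (pair (fstSec v) 0) + (D (pair (fstSec u) 0) (pair 0 (sndSec v)) +
        D (pair 0 (sndSec u)) (pair 0 (sndSec v))) := by
      conv_lhs => rw [eq_pair_add_pair u, eq_pair_add_pair v]
      simp only [hD.add_left, hD.add_right]
      abel
    rw [← pair_fstSec_sndSec (D u v), phaseProduct, hdual, hbidual, h1]
    simp only [fstSec_add, sndSec_add, hfst, hsnd, add_zero, zero_add]
    rfl
  have hg := isPseudoRiemannian_phaseMetric (E := E) (F := F) (B := B)
  have hflatS : ∀ X Y Z, curvature S X Y Z = 0 := by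
    intro X Y Z
    refine sec_ext_of_dual fun γ x => ?_
    -- `⟨R(X, Y) Z, γ⟩ = ⟨R(Z, γ) X, Y⟩ = 0` since `B` is isotropic and preserved by `D`
    have h1 := hD.curvature_pair_symm hg (pair X 0) (pair Y 0) (pair Z 0) (pair 0 γ) x
    rw [hDeq] at h1
    have h2 := DFunLike.congr_fun (sndSec_curvature_fst hS hT (pair X 0) (pair Y 0) Z) x
    have h3 := DFunLike.congr_fun (sndSec_curvature_fst hS hT (pair Z 0) (pair 0 γ) X) x
    rw [← fstSec_curvature_fst hS hT]
    simp only [sndSec_apply] at h2 h3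
    simp only [phaseMetric_apply, pair_apply, h2, h3, ContMDiffSection.coe_zero, Pi.zero_apply,
      zero_apply, zero_add] at h1
    rw [ContMDiffSection.coe_zero, Pi.zero_apply, map_zero]
    exact h1
  have hflatT : ∀ α β γ, curvature T α β γ = 0 := by
    intro α β γ
    refine dualSec_ext fun Z x => ?_
    have h1 := hD.curvature_pair_symm hg (pair 0 α) (pair 0 β) (pair 0 γ) (pair Z 0) x
    rw [hDeq] at h1
    have h2 := DFunLike.congr_fun (fstSec_curvature_snd hS hT (pair 0 α) (pair 0 β) γ) x
    have h3 := DFunLike.congr_fun (fstSec_curvature_snd hS hT (pair 0 γ) (pair Z 0) α) x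
    rw [← sndSec_curvature_snd hS hT]
    simp only [fstSec_apply] at h2 h3
    simp only [phaseMetric_apply, pair_apply, h2, h3, ContMDiffSection.coe_zero, Pi.zero_apply,
      map_zero, add_zero] at h1
    exact h1
  have hS' : IsLeftSymmetricAlgebroid ρ₀ S := ⟨hS, hflatS⟩
  have hT' : IsLeftSymmetricAlgebroid ρ₁ T := ⟨hT, hflatT⟩
  refine ⟨ρ₀, S, ρ₁, T, hS', hT', ⟨fun X Y α => ?_, fun X α β => ?_⟩, hρ, hDeq⟩
  · have h1 := hD.bianchi (pair X 0) (pair 0 α) (pair Y 0)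
    rw [hD.curvature_swap (pair 0 α)] at h1
    rw [hDeq] at h1
    rw [curvature_fst_fst_snd hS' hT, add_zero] at h1
    exact add_neg_eq_zero.1 h1
  · have h1 := hD.bianchi (pair 0 α) (pair X 0) (pair 0 β)
    rw [hD.curvature_swap (pair X 0)] at h1
    rw [hDeq] at h1
    rw [curvature_snd_snd_fst hS hT', add_zero] at h1
    exact add_neg_eq_zero.1 h1

end Extendible

/-! ### The decomposition of a para-Kähler Lie algebroid -/

/-- Linear algebra in a fibre: a nondegenerate form with a skew-symmetric involution `K` is the
canonical form on `W ⊕ W*`, for `W` the `+1`-eigenspace of `K`, included by `ι`, with the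
projection `p` along the `-1`-eigenspace. -/
theorem exists_prod_dual_equiv {V W : Type*} [AddCommGroup V] [Module ℝ V] [AddCommGroup W]
    [Module ℝ W] {g : V →ₗ[ℝ] V →ₗ[ℝ] ℝ} (hsymm : ∀ u v, g u v = g v u)
    (hbij : Function.Bijective g) {K : V →ₗ[ℝ] V} (hsq : ∀ u, K (K u) = u)
    (hskew : ∀ u v, g (K u) v = -g u (K v)) {ι : W →ₗ[ℝ] V} {p : V →ₗ[ℝ] W}
    (hι : ∀ w, K (ι w) = ι w) (hpι : ∀ w, p (ι w) = w)
    (hιp : ∀ z, ι (p z) = (1 / 2 : ℝ) • (z + K z)) :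
    ∃ e : (W × Module.Dual ℝ W) ≃ₗ[ℝ] V, (∀ w α, K (e (w, α)) = e (w, -α)) ∧
      (∀ w α w' α', g (e (w, α)) (e (w', α')) = α w' + α' w) ∧
      (∀ w α z, g (e (w, α)) z = g (ι w) z + α (p z)) ∧
      ∀ z, e.symm z = (p z, (g z).comp ι) := by
  have hinj : Function.Injective ι := Function.LeftInverse.injective hpι
  let G := LinearEquiv.ofBijective g hbij
  let θ : Module.Dual ℝ W →ₗ[ℝ] V := G.symm.toLinearMap ∘ₗ p.lcomp ℝ ℝ
  have hθ : ∀ α z, g (θ α) z = α (p z) := fun α z =>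
    LinearMap.congr_fun (G.apply_symm_apply (p.lcomp ℝ ℝ α)) z
  have hpK : ∀ z, p (K z) = p z := fun z => hinj (by rw [hιp, hιp, hsq, add_comm])
  have hKθ : ∀ α, K (θ α) = -θ α := fun α => hbij.1 <| LinearMap.ext fun z => by
    rw [hskew, hθ, hpK, map_neg, LinearMap.neg_apply, hθ]
  have hpθ : ∀ α, p (θ α) = 0 := fun α => hinj (by
    rw [hιp, hKθ, add_neg_cancel, smul_zero, map_zero])
  have hiso : ∀ w w', g (ι w) (ι w') = 0 := fun w w' => by
    have h := hskew (ι w) (ι w')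
    rw [hι, hι] at h
    linarith
  have hiso' : ∀ α β, g (θ α) (θ β) = 0 := fun α β => by rw [hθ, hpθ, map_zero]
  let e : (W × Module.Dual ℝ W) ≃ₗ[ℝ] V := LinearEquiv.ofLinearMap (ι.coprod θ)
    (p.prod (ι.lcomp ℝ ℝ ∘ₗ g))
    (LinearMap.ext fun z => hbij.1 <| LinearMap.ext fun z' => by
      have h1 : g (ι (p z) + θ ((g z).comp ι)) z' = g z z' := by
        rw [map_add, LinearMap.add_apply, hθ, LinearMap.comp_apply, hιp, hιp]
        simp only [map_smul, map_add, LinearMap.smul_apply, LinearMap.add_apply, smul_eq_mul, hskew]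
        ring
      exact h1)
    (LinearMap.ext fun ⟨w, α⟩ => by
      refine Prod.ext ?_ (LinearMap.ext fun v => ?_)
      · show p (ι w + θ α) = w
        rw [map_add, hpι, hpθ, add_zero]
      · show g (ι w + θ α) (ι v) = α v
        rw [map_add, LinearMap.add_apply, hiso, hθ, hpι, zero_add])
  have he : ∀ w α, e (w, α) = ι w + θ α := fun _ _ => rfl
  refine ⟨e, fun w α => ?_, fun w α w' α' => ?_, fun w α z => ?_, fun z => rfl⟩
  · rw [he, he, map_add, hι, hKθ, map_neg]
  · rw [he, he, map_add, map_add, LinearMap.add_apply, LinearMap.add_apply, hiso, hiso',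
      hsymm (ι w), hθ, hθ, hpι, hpι]
    ring
  · rw [he, map_add, LinearMap.add_apply, hθ]

section Transport

variable {E : Type*} [NormedAddCommGroup E] [NormedSpace ℝ E] [FiniteDimensional ℝ E]
  {M : Type*} [TopologicalSpace M] [ChartedSpace E M] [IsManifold 𝓘(ℝ, E) ∞ M] [T2Space M]
  {F : Type*} [NormedAddCommGroup F] [NormedSpace ℝ F] [FiniteDimensional ℝ F]
  {A : M → Type*} [∀ x, AddCommGroup (A x)] [∀ x, Module ℝ (A x)] [∀ x, TopologicalSpace (A x)]
  [TopologicalSpace (TotalSpace F A)] [FiberBundle F A] [VectorBundle ℝ F A]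
  [ContMDiffVectorBundle ∞ F A 𝓘(ℝ, E)]

section

variable {F' : Type*} [NormedAddCommGroup F'] [NormedSpace ℝ F'] [FiniteDimensional ℝ F']
  {A' : M → Type*} [∀ x, AddCommGroup (A' x)] [∀ x, Module ℝ (A' x)]
  [∀ x, TopologicalSpace (A' x)]
  [TopologicalSpace (TotalSpace F' A')] [FiberBundle F' A'] [VectorBundle ℝ F' A']
  [ContMDiffVectorBundle ∞ F' A' 𝓘(ℝ, E)]

theorem mapSec_add {H : ∀ x, A x →ₗ[ℝ] A' x} (hH : IsSmoothHom E F F' H) (s t : Sec E F A) :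
    mapSec hH (s + t) = mapSec hH s + mapSec hH t :=
  ContMDiffSection.ext fun x => (H x).map_add _ _

theorem mapSec_sub {H : ∀ x, A x →ₗ[ℝ] A' x} (hH : IsSmoothHom E F F' H) (s t : Sec E F A) :
    mapSec hH (s - t) = mapSec hH s - mapSec hH t :=
  ContMDiffSection.ext fun x => (H x).map_sub _ _

theorem mapSec_zero {H : ∀ x, A x →ₗ[ℝ] A' x} (hH : IsSmoothHom E F F' H) :
    mapSec hH (0 : Sec E F A) = 0 :=
  ContMDiffSection.ext fun x => (H x).map_zero

theorem mapSec_fun_smul {H : ∀ x, A x →ₗ[ℝ] A' x} (hH : IsSmoothHom E F F' H) (f : Fun E M)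
    (s : Sec E F A) : mapSec hH (f • s) = f • mapSec hH s :=
  ContMDiffSection.ext fun x => (H x).map_smul _ _

variable {Ψ : ∀ x, A' x ≃ₗ[ℝ] A x}
  (hΨ : IsSmoothHom E F' F fun x => (Ψ x : A' x →ₗ[ℝ] A x))
  (hΨ' : IsSmoothHom E F F' fun x => ((Ψ x).symm : A x →ₗ[ℝ] A' x))

theorem mapSec_mapSec_symm (s : Sec E F A) : mapSec hΨ (mapSec hΨ' s) = s :=
  ContMDiffSection.ext fun x => (Ψ x).apply_symm_apply _

theorem mapSec_symm_mapSec (s : Sec E F' A') : mapSec hΨ' (mapSec hΨ s) = s :=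
  ContMDiffSection.ext fun x => (Ψ x).symm_apply_apply _

/-- The product on `A'` corresponding to a product on `A` under an isomorphism `A' → A`. -/
def pullbackProduct (D : Sec E F A → Sec E F A → Sec E F A) (a b : Sec E F' A') : Sec E F' A' :=
  mapSec hΨ' (D (mapSec hΨ a) (mapSec hΨ b))

theorem mapSec_pullbackProduct (D : Sec E F A → Sec E F A → Sec E F A) (a b : Sec E F' A') :
    mapSec hΨ (pullbackProduct hΨ hΨ' D a b) = D (mapSec hΨ a) (mapSec hΨ b) :=
  mapSec_mapSec_symm hΨ hΨ' _

theorem mapSec_prodBracket_pullbackProduct (D : Sec E F A → Sec E F A → Sec E F A)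
    (a b : Sec E F' A') : mapSec hΨ (prodBracket (pullbackProduct hΨ hΨ' D) a b) =
      prodBracket D (mapSec hΨ a) (mapSec hΨ b) := by
  rw [prodBracket, mapSec_sub, mapSec_pullbackProduct, mapSec_pullbackProduct, prodBracket]

theorem mapSec_curvature_pullbackProduct (D : Sec E F A → Sec E F A → Sec E F A)
    (a b c : Sec E F' A') : mapSec hΨ (curvature (pullbackProduct hΨ hΨ' D) a b c) =
      curvature D (mapSec hΨ a) (mapSec hΨ b) (mapSec hΨ c) := by
  simp only [curvature, mapSec_sub, mapSec_pullbackProduct, mapSec_prodBracket_pullbackProduct]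

theorem IsLeviCivitaProduct.pullback {ρ : ∀ x, A x →ₗ[ℝ] TangentSpace 𝓘(ℝ, E) x}
    {g : ∀ x, A x →ₗ[ℝ] A x →ₗ[ℝ] ℝ} {D : Sec E F A → Sec E F A → Sec E F A}
    (hD : IsLeviCivitaProduct ρ g D) {g' : ∀ x, A' x →ₗ[ℝ] A' x →ₗ[ℝ] ℝ}
    (hg' : ∀ x v w, g x (Ψ x v) (Ψ x w) = g' x v w) :
    IsLeviCivitaProduct (fun x => ρ x ∘ₗ (Ψ x : A' x →ₗ[ℝ] A x)) g'
      (pullbackProduct hΨ hΨ' D) where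
  toIsRightAnchoredProduct := by
    refine isRightAnchoredProduct_of_fun
      (isSmoothHom_of_sec _ fun s => (mapSec hD.smooth_anchor (mapSec hΨ s)).contMDiff)
      (fun a b c => ?_) (fun a b c => ?_) (fun f a b => ?_) (fun f a b x => ?_)
    · simp only [pullbackProduct, mapSec_add, hD.add_left]
    · simp only [pullbackProduct, mapSec_add, hD.add_right]
    · simp only [pullbackProduct, mapSec_fun_smul, hD.fun_smul_left]
    · simp only [pullbackProduct, mapSec_fun_smul, hD.fun_smul_right_eq, mapSec_add,
        mapSec_symm_mapSec]
      rfl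
  metric a b c x := by
    have h := hD.metric (mapSec hΨ a) (mapSec hΨ b) (mapSec hΨ c) x
    rw [← mapSec_pullbackProduct hΨ hΨ' D, ← mapSec_pullbackProduct hΨ hΨ' D] at h
    simp only [mapSec_apply, LinearEquiv.coe_coe, hg'] at h
    exact h
  bianchi a b c := by
    have h := hD.bianchi (mapSec hΨ a) (mapSec hΨ b) (mapSec hΨ c)
    simp only [← mapSec_curvature_pullbackProduct hΨ hΨ', ← mapSec_add] at h
    rw [← mapSec_symm_mapSec hΨ hΨ' (_ + _ + _), h, mapSec_zero]

end

/-- A para-Kähler Lie algebroid is the phase space of any smooth bundle `B` included by `ι` onto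
the `+1`-eigenbundle of `K`. -/
theorem IsParaKahler.exists_phase {F' : Type*} [NormedAddCommGroup F'] [NormedSpace ℝ F']
    [FiniteDimensional ℝ F']
    {B : M → Type*} [∀ x, AddCommGroup (B x)] [∀ x, Module ℝ (B x)] [∀ x, TopologicalSpace (B x)]
    [TopologicalSpace (TotalSpace F' B)] [FiberBundle F' B] [VectorBundle ℝ F' B]
    [ContMDiffVectorBundle ∞ F' B 𝓘(ℝ, E)]
    {ρ : ∀ x, A x →ₗ[ℝ] TangentSpace 𝓘(ℝ, E) x} {br : Sec E F A → Sec E F A → Sec E F A}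
    {g : ∀ x, A x →ₗ[ℝ] A x →ₗ[ℝ] ℝ} {K : ∀ x, A x →ₗ[ℝ] A x} (h : IsParaKahler ρ br g K)
    (ι : ∀ x, B x →ₗ[ℝ] A x) (p : ∀ x, A x →ₗ[ℝ] B x)
    (hι : ∀ x w, K x (ι x w) = ι x w) (hpι : ∀ x w, p x (ι x w) = w)
    (hιp : ∀ x z, ι x (p x z) = (1 / 2 : ℝ) • (z + K x z))
    (hsm : ∀ s : ∀ x, B x,
      ContMDiff 𝓘(ℝ, E) (𝓘(ℝ, E).prod 𝓘(ℝ, F')) ∞ (fun x => (⟨x, s x⟩ : TotalSpace F' B)) ↔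
      ContMDiff 𝓘(ℝ, E) (𝓘(ℝ, E).prod 𝓘(ℝ, F)) ∞
        (fun x => (⟨x, ι x (s x)⟩ : TotalSpace F A))) :
    ∃ (ρ₀ : ∀ x, B x →ₗ[ℝ] TangentSpace 𝓘(ℝ, E) x) (S : Sec E F' B → Sec E F' B → Sec E F' B)
      (ρ₁ : ∀ x, Dual B x →ₗ[ℝ] TangentSpace 𝓘(ℝ, E) x)
      (T : Sec E (F' →L[ℝ] ℝ) (Dual B) → Sec E (F' →L[ℝ] ℝ) (Dual B) →
        Sec E (F' →L[ℝ] ℝ) (Dual B))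
      (hS : IsLeftSymmetricAlgebroid ρ₀ S) (hT : IsLeftSymmetricAlgebroid ρ₁ T)
      (Ψ : ∀ x, Phase B x ≃ₗ[ℝ] A x)
      (hΨ : IsSmoothHom E (F' × (F' →L[ℝ] ℝ)) F fun x => (Ψ x : Phase B x →ₗ[ℝ] A x)),
      IsLieExtendible hS.toIsRightAnchoredProduct hT.toIsRightAnchoredProduct ∧
      IsSmoothHom E F (F' × (F' →L[ℝ] ℝ))
        (fun x => ((Ψ x).symm : A x →ₗ[ℝ] Phase B x)) ∧
      (∀ x v, ρ x (Ψ x v) = phaseAnchor ρ₀ ρ₁ x v) ∧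
      (∀ u v, mapSec hΨ
          (phaseBracket hS.toIsRightAnchoredProduct hT.toIsRightAnchoredProduct u v) =
        br (mapSec hΨ u) (mapSec hΨ v)) ∧
      (∀ x v w, g x (Ψ x v) (Ψ x w) = phaseMetric x v w) ∧
      (∀ x v, K x (Ψ x v) = Ψ x (phaseK x v)) := by
  have hg := h.metric
  have hιs : IsSmoothHom E F' F ι := isSmoothHom_of_sec ι fun s => (hsm s).1 s.contMDiff
  have hps : IsSmoothHom E F F' p := isSmoothHom_of_sec p fun s => by
    refine (hsm fun x => p x (s x)).2 ?_
    simp only [hιp]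
    exact ((1 / 2 : ℝ) • (s + mapSec h.smooth s)).contMDiff
  choose e heK heg hez hes using fun x => exists_prod_dual_equiv (hg.symm x) (hg.bijective x)
    (h.sq x) (h.skew x) (hι x) (hpι x) (hιp x)
  let δ : ∀ x, Dual B x ≃ₗ[ℝ] Module.Dual ℝ (B x) := fun x =>
    LinearEquiv.ofBijective (evalDual x) (evalDual_bijective F' x)
  let Ψ : ∀ x, Phase B x ≃ₗ[ℝ] A x := fun x =>
    ((LinearEquiv.refl ℝ (B x)).prodCongr (δ x)).trans (e x)
  have hΨe : ∀ x v, Ψ x v = e x (v.1, δ x v.2) := fun x v => rfl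
  have hΨ : IsSmoothHom E (F' × (F' →L[ℝ] ℝ)) F fun x => (Ψ x : Phase B x →ₗ[ℝ] A x) := by
    refine isSmoothHom_of_sec _ fun u => ?_
    obtain ⟨t, ht⟩ := exists_sec_of_tensorial g hg.bijective hg.contMDiff
      (fun z x => g x (ι x (u x).1) (z x) + (u x).2 (p x (z x)))
      (fun z => (hg.contMDiff (mapSec hιs (fstSec u)) z).add
        (contMDiff_dual_apply (sndSec u) (mapSec hps z)))
      (fun z z' x => by
        simp only [ContMDiffSection.coe_add, Pi.add_apply, map_add]; ring)
      (fun f z x => by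
        simp only [fun_smul_apply, map_smul, smul_eq_mul]; ring)
    have h1 : ∀ x, t x = Ψ x (u x) := fun x => (hg.bijective x).1 <| LinearMap.ext fun v => by
      obtain ⟨z, rfl⟩ := exists_sec_apply_eq (E := E) (F := F) x v
      rw [ht, hΨe, hez]
      rfl
    simp only [LinearEquiv.coe_coe, ← h1]
    exact t.contMDiff
  have hΨ' : IsSmoothHom E F (F' × (F' →L[ℝ] ℝ))
      (fun x => ((Ψ x).symm : A x →ₗ[ℝ] Phase B x)) := by
    refine isSmoothHom_of_sec _ fun s => ?_
    obtain ⟨t, ht⟩ := exists_sec_of_tensorial evalDual (evalDual_bijective F') contMDiff_dual_apply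
      (fun (z : Sec E F' B) x => g x (s x) (ι x (z x)))
      (fun z => hg.contMDiff s (mapSec hιs z))
      (fun z z' x => by simp only [ContMDiffSection.coe_add, Pi.add_apply, map_add])
      (fun f z x => by simp only [fun_smul_apply, map_smul, smul_eq_mul])
    have h1 : ∀ x, pair (mapSec hps s) t x = (Ψ x).symm (s x) := fun x => by
      rw [LinearEquiv.eq_symm_apply, hΨe, ← LinearEquiv.eq_symm_apply, hes]
      refine Prod.ext rfl (LinearMap.ext fun v => ?_)
      obtain ⟨z, rfl⟩ := exists_sec_apply_eq (E := E) (F := F') x v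
      exact ht z x
    simp only [LinearEquiv.coe_coe, ← h1]
    exact (pair (mapSec hps s) t).contMDiff
  have hΨg : ∀ x v w, g x (Ψ x v) (Ψ x w) = phaseMetric x v w := fun x v w => by
    rw [hΨe, hΨe, heg]
    rfl
  have hΨK : ∀ x v, K x (Ψ x v) = Ψ x (phaseK x v) := fun x v => by
    rw [hΨe, hΨe, heK, ← map_neg]
    rfl
  have hD := (h.lie.isLeviCivitaProduct_leviCivita hg).pullback hΨ hΨ' hΨg
  have hbr := h.lie.prodBracket_leviCivita hg
  obtain ⟨ρ₀, S, ρ₁, T, hS, hT, hext, hρ, hDeq⟩ := hD.exists_eq_phaseProduct (fun u v => by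
    have h1 : ∀ u, mapSec hΨ (mapSec isSmoothHom_phaseK u) = mapSec h.smooth (mapSec hΨ u) :=
      fun u => ContMDiffSection.ext fun x => (hΨK x (u x)).symm
    rw [← mapSec_symm_mapSec hΨ hΨ' (pullbackProduct _ _ _ _ _), mapSec_pullbackProduct, h1,
      h.parallel, ← mapSec_pullbackProduct hΨ hΨ' (leviCivita _ _), ← h1, mapSec_symm_mapSec])
  refine ⟨ρ₀, S, ρ₁, T, hS, hT, Ψ, hΨ, hext, hΨ', fun x v => ?_, fun u v => ?_, hΨg, hΨK⟩
  · rw [← hρ]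
    rfl
  · rw [← prodBracket_phaseProduct, ← hDeq, mapSec_prodBracket_pullbackProduct, hbr]

end Transport

end ParaKahler

end

theorem theorem3p1
    {E : Type uE} [NormedAddCommGroup E] [NormedSpace ℝ E] [FiniteDimensional ℝ E]
    {M : Type uM} [TopologicalSpace M] [ChartedSpace E M] [IsManifold 𝓘(ℝ, E) ∞ M] [T2Space M] :
    -- the phase space of two Lie-extendible left symmetric algebroids is para-Kähler
    (∀ (F : Type uF) [NormedAddCommGroup F] [NormedSpace ℝ F] [FiniteDimensional ℝ F]
      (B : M → Type uA) [∀ x, AddCommGroup (B x)] [∀ x, Module ℝ (B x)]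
      [∀ x, TopologicalSpace (B x)] [TopologicalSpace (TotalSpace F B)] [FiberBundle F B]
      [VectorBundle ℝ F B] [ContMDiffVectorBundle ∞ F B 𝓘(ℝ, E)]
      (ρ₀ : ∀ x, B x →ₗ[ℝ] TangentSpace 𝓘(ℝ, E) x)
      (S : ParaKahler.Sec E F B → ParaKahler.Sec E F B → ParaKahler.Sec E F B)
      (ρ₁ : ∀ x, ParaKahler.Dual B x →ₗ[ℝ] TangentSpace 𝓘(ℝ, E) x)
      (T : ParaKahler.Sec E (F →L[ℝ] ℝ) (ParaKahler.Dual B) →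
        ParaKahler.Sec E (F →L[ℝ] ℝ) (ParaKahler.Dual B) →
        ParaKahler.Sec E (F →L[ℝ] ℝ) (ParaKahler.Dual B))
      (hS : ParaKahler.IsLeftSymmetricAlgebroid ρ₀ S)
      (hT : ParaKahler.IsLeftSymmetricAlgebroid ρ₁ T),
      ParaKahler.IsLieExtendible hS.toIsRightAnchoredProduct hT.toIsRightAnchoredProduct →
      ParaKahler.IsParaKahler (ParaKahler.phaseAnchor ρ₀ ρ₁)
        (ParaKahler.phaseBracket hS.toIsRightAnchoredProduct hT.toIsRightAnchoredProduct)
        ParaKahler.phaseMetric ParaKahler.phaseK) ∧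
    -- every para-Kähler Lie algebroid is isomorphic to such a phase space
    (∀ (F : Type uF) [NormedAddCommGroup F] [NormedSpace ℝ F] [FiniteDimensional ℝ F]
      (A : M → Type uA) [∀ x, AddCommGroup (A x)] [∀ x, Module ℝ (A x)]
      [∀ x, TopologicalSpace (A x)] [TopologicalSpace (TotalSpace F A)] [FiberBundle F A]
      [VectorBundle ℝ F A] [ContMDiffVectorBundle ∞ F A 𝓘(ℝ, E)]
      (ρ : ∀ x, A x →ₗ[ℝ] TangentSpace 𝓘(ℝ, E) x)
      (br : ParaKahler.Sec E F A → ParaKahler.Sec E F A → ParaKahler.Sec E F A)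
      (g : ∀ x, A x →ₗ[ℝ] A x →ₗ[ℝ] ℝ) (K : ∀ x, A x →ₗ[ℝ] A x),
      ParaKahler.IsParaKahler ρ br g K →
      ∃ (n : ℕ) (B : M → Type uA) (_ : ∀ x, AddCommGroup (B x)) (_ : ∀ x, Module ℝ (B x))
        (_ : ∀ x, TopologicalSpace (B x))
        (_ : TopologicalSpace (TotalSpace (EuclideanSpace ℝ (Fin n)) B))
        (_ : FiberBundle (EuclideanSpace ℝ (Fin n)) B)
        (_ : VectorBundle ℝ (EuclideanSpace ℝ (Fin n)) B)
        (_ : ContMDiffVectorBundle ∞ (EuclideanSpace ℝ (Fin n)) B 𝓘(ℝ, E))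
        (ρ₀ : ∀ x, B x →ₗ[ℝ] TangentSpace 𝓘(ℝ, E) x)
        (S : ParaKahler.Sec E (EuclideanSpace ℝ (Fin n)) B →
          ParaKahler.Sec E (EuclideanSpace ℝ (Fin n)) B →
          ParaKahler.Sec E (EuclideanSpace ℝ (Fin n)) B)
        (ρ₁ : ∀ x, ParaKahler.Dual B x →ₗ[ℝ] TangentSpace 𝓘(ℝ, E) x)
        (T : ParaKahler.Sec E (EuclideanSpace ℝ (Fin n) →L[ℝ] ℝ) (ParaKahler.Dual B) →
          ParaKahler.Sec E (EuclideanSpace ℝ (Fin n) →L[ℝ] ℝ) (ParaKahler.Dual B) →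
          ParaKahler.Sec E (EuclideanSpace ℝ (Fin n) →L[ℝ] ℝ) (ParaKahler.Dual B))
        (hS : ParaKahler.IsLeftSymmetricAlgebroid ρ₀ S)
        (hT : ParaKahler.IsLeftSymmetricAlgebroid ρ₁ T)
        (Ψ : ∀ x, ParaKahler.Phase B x ≃ₗ[ℝ] A x)
        (hΨ : ParaKahler.IsSmoothHom E
          (EuclideanSpace ℝ (Fin n) × (EuclideanSpace ℝ (Fin n) →L[ℝ] ℝ)) F
          (fun x => (Ψ x : ParaKahler.Phase B x →ₗ[ℝ] A x))),
        ParaKahler.IsLieExtendible hS.toIsRightAnchoredProduct hT.toIsRightAnchoredProduct ∧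
        ParaKahler.IsSmoothHom E F
          (EuclideanSpace ℝ (Fin n) × (EuclideanSpace ℝ (Fin n) →L[ℝ] ℝ))
          (fun x => ((Ψ x).symm : A x →ₗ[ℝ] ParaKahler.Phase B x)) ∧
        (∀ x v, ρ x (Ψ x v) = ParaKahler.phaseAnchor ρ₀ ρ₁ x v) ∧
        (∀ u v, ParaKahler.mapSec hΨ
            (ParaKahler.phaseBracket hS.toIsRightAnchoredProduct hT.toIsRightAnchoredProduct u v) =
          br (ParaKahler.mapSec hΨ u) (ParaKahler.mapSec hΨ v)) ∧
        (∀ x v w, g x (Ψ x v) (Ψ x w) = ParaKahler.phaseMetric x v w) ∧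
        (∀ x v, K x (Ψ x v) = Ψ x (ParaKahler.phaseK x v))) := by
  refine ⟨fun F _ _ _ B _ _ _ _ _ _ _ ρ₀ S ρ₁ T hS hT h => ParaKahler.isParaKahler_phase hS hT h,
    fun F _ _ _ A _ _ _ _ _ _ _ ρ br g K h => ?_⟩
  let W : ∀ x, Submodule ℝ (A x) := fun x => LinearMap.eqLocus (K x) LinearMap.id
  have hhalf : ∀ x z, (1 / 2 : ℝ) • (z + K x z) ∈ W x := fun x z => by
    show K x ((1 / 2 : ℝ) • (z + K x z)) = (1 / 2 : ℝ) • (z + K x z)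
    rw [map_smul, map_add, h.sq, add_comm]
  let B : M → Type uA := fun x => W x
  let ι : ∀ x, B x →ₗ[ℝ] A x := fun x => (W x).subtype
  let p : ∀ x, A x →ₗ[ℝ] B x := fun x =>
    LinearMap.codRestrict (W x) ((1 / 2 : ℝ) • (LinearMap.id + K x)) (hhalf x)
  have hι : ∀ x w, K x (ι x w) = ι x w := fun x w => w.2
  have hιp : ∀ x z, ι x (p x z) = (1 / 2 : ℝ) • (z + K x z) := fun x z => rfl
  have hpι : ∀ x w, p x (ι x w) = w := fun x w => Subtype.ext <| by
    refine (hιp x (ι x w)).trans ?_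
    rw [hι, ← two_smul ℝ, smul_smul]
    norm_num
    rfl
  have hfd : ∀ x, FiniteDimensional ℝ (A x) := fun x => ParaKahler.finiteDimensional_fibre F x
  have hfdB : ∀ x, FiniteDimensional ℝ (B x) := fun x => inferInstanceAs (FiniteDimensional ℝ (W x))
  -- `A x ≃ B x × (B x)*` has the rank of `A`, so that `B` has half of it
  have hn : ∀ x, Module.finrank ℝ (B x) = Module.finrank ℝ F / 2 := by
    intro x
    obtain ⟨e, -⟩ := ParaKahler.exists_prod_dual_equiv (h.metric.symm x) (h.metric.bijective x)
      (h.sq x) (h.skew x) (hι x) (hpι x) (hιp x)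
    have h1 := e.finrank_eq
    rw [Module.finrank_prod, Subspace.dual_finrank_eq,
      ((trivializationAt F A x).linearEquivAt ℝ x
        (mem_baseSet_trivializationAt F A x)).finrank_eq] at h1
    omega
  obtain ⟨τ, τt, fb, vb, sm, hsm⟩ := ParaKahler.exists_subbundle (E := E) (F := F)
    (Module.finrank ℝ F / 2) ι (fun x => Subtype.val_injective) hn (fun x₀ v => by
      obtain ⟨s, hs⟩ := ParaKahler.exists_sec_apply_eq (E := E) (F := F) x₀ (ι x₀ v)
      refine ⟨(1 / 2 : ℝ) • (s + ParaKahler.mapSec h.smooth s), fun x => ⟨p x (s x), rfl⟩, ?_⟩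
      show (1 / 2 : ℝ) • (s x₀ + K x₀ (s x₀)) = ι x₀ v
      rw [hs, ← hιp, hpι])
  exact ⟨Module.finrank ℝ F / 2, B, inferInstance, inferInstance, τ, τt, fb, vb, sm,
    h.exists_phase ι p hι hpι hιp hsm⟩
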